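/- Let $k$ be an algebraically closed field of characteristic $0$, $K\supset k$ a field, and $C$ a smooth projective (integral) curve over $K$. Let $\mathcal D=\sum_x m_x x$ be an effective divisor on $C$ supported at $K$-rational points, $D$ its support with reduced structure, and $\mathcal D'=\mathcal D-D$. Let $\Omega^p_C$ be the sheaf of absolute $p$-forms (over $k$) on $C$, $\Omega^p_C\langle D\rangle$ the sheaf of absolute $p$-forms with logarithmic poles along $D$, and $\Omega^p_C\langle D\rangle(\mathcal D')=\Omega^p_C\langle D\rangle\otimes\mathcal O_C(\mathcal D')$. Let $\mathcal K_2$ be the Zariski sheaf associated to Milnor $K_2$, mapped to $\Omega^2_C$ by $\{a,b\}\mapsto \frac{da}{a}\wedge\frac{db}{b}$. Let $E$ be a vector bundle of rank $r$ on $C$ with a connection $\nabla:E\to E\otimes\Omega^1_C\langle D\rangle(\mathcal D')$ over $k$, let $L$ be a line bundle on $C$, and let $g:E|_{\mathcal D}\cong (E\otimes L)|_{\mathcal D}$ be an isomorphism of $\mathcal O_{\mathcal D}$-modules that commutes with the $\mathcal O_C$-linear map $\nabla|_{\mathcal D}:E\to E\otimes\big(\Omega^1_C\langle D\rangle(\mathcal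 D')/\Omega^1_C\big)$ induced by $\nabla$. Choose an open covering $\{U_i\}$ of $C$ by nonempty open sets, frames $e_i$ of $E$ and generators $\ell_i$ of $L$ on $U_i$, and write $e_i=c_{ij}e_j$, $\ell_i=\lambda_{ij}\ell_j$ with $c_{ij}\in GL_r(\mathcal O(U_i\cap U_j))$, $\lambda_{ij}\in\mathcal O^*(U_i\cap U_j)$, and $\nabla e_i=\omega_ie_i$, where $\omega_i$ is an $r\times r$ matrix of sections of $\Omega^1_C\langle D\rangle(\mathcal D')$ over $U_i$. Let $\tilde\mu_i\in GL_r(\mathcal O(U_i))$ lift the local matrix $\mu_i\in GL_r(\mathcal O_{\mathcal D\cap U_i})$ of the trivialization, normalized by $g(\mu_ie_i)=e_i\otimes\ell_i$, so that $\mu_i=c_{ij}\mu_jc_{ij}^{-1}\lambda_{ij}$ along $\mathcal D$. Such choices exist for suitable coverings. Then, for every such choice, the Čech cochain $$\Big(\{\lambda_{ij},\det c_{jk}\},\ d\log\lambda_{ij}\wedge{\rm Tr}(\omega_j),\ {\rm Tr}(-d\tilde\mu_i\tilde\mu_i^{-1}\wedge\omega_i)\Big)$$ is a cocycle of total degree $2$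 with values in the complex $$\mathcal K_2\to\Omega^2_C\langle D\rangle(\mathcal D')\to\Omega^2_C\langle D\rangle(\mathcal D')/\Omega^2_C ,$$ that is, it consists of sections of these sheaves, and, denoting it by $(a,b,c)$ and the Čech coboundary by $\delta$, one has $\delta a=0$, $\delta b=d\log a$, and $\delta c=b$ modulo $\Omega^2_C$. Its class $\{c_1(L),g,\nabla\}$ in $$\mathbb H^2\Big(C,\ \mathcal K_2\to\Omega^2_C\langle D\rangle(\mathcal D')\to\Omega^2_C\langle D\rangle(\mathcal D')/\Omega^2_C\Big)$$ (the colimit, over all open coverings of $C$, of the second cohomology groups of the total Čech complexes) does not depend on the covering, the frames or the liftings. -/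

import Mathlib

open CategoryTheory AlgebraicGeometry TopologicalSpace Opposite TensorProduct

universe u v

noncomputable section

/-! ### Exterior products of differentials -/

section Wedge

variable (k : Type v) (F : Type u) [Field k] [Field F] [Algebra k F]

/-- Differential two-forms of the field extension `F / k`. -/
abbrev TwoForms : Type u := ⋀[F]^2 Ω[F⁄k]

/-- The exterior product of two one-forms. -/
def wedge : Ω[F⁄k] →ₗ[F] Ω[F⁄k] →ₗ[F] TwoForms k F :=
  have h0 (a b x : Ω[F⁄k]) : Function.update ![a, b] 0 x = ![x, b] := by
    ext i; fin_cases i <;> rfl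
  have h1 (a b x : Ω[F⁄k]) : Function.update ![a, b] 1 x = ![a, x] := by
    ext i; fin_cases i <;> rfl
  let w := exteriorPower.ιMulti F 2 (M := Ω[F⁄k])
  LinearMap.mk₂ F (fun a b => w ![a, b])
    (fun a a' b => by simpa only [h0] using w.map_update_add ![a, b] 0 a a')
    (fun c a b => by simpa only [h0] using w.map_update_smul ![a, b] 0 c a)
    (fun a b b' => by simpa only [h1] using w.map_update_add ![a, b] 1 b b')
    (fun c a b => by simpa only [h1] using w.map_update_smul ![a, b] 1 c b)

theorem wedge_self (a : Ω[F⁄k]) : wedge k F a a = 0 :=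
  (exteriorPower.ιMulti F 2 (M := Ω[F⁄k])).map_eq_zero_of_eq ![a, a] (i := 0) (j := 1) rfl
    (by decide)

/-- The logarithmic differential `a⁻¹ da`. -/
def dlogForm (a : F) : Ω[F⁄k] := a⁻¹ • KaehlerDifferential.D k F a

end Wedge

/-! ### Milnor `K₂` and its logarithmic differential -/

section Milnor

variable (R : Type u) [CommRing R]

/-- The Steinberg relations `a ⊗ (1 - a)`, with `a` and `1 - a` units. -/
def steinberg : AddSubgroup (Additive Rˣ ⊗[ℤ] Additive Rˣ) :=
  AddSubgroup.closure
    {t | ∃ a b : Rˣ, (a : R) + (b : R) = 1 ∧ t = Additive.ofMul a ⊗ₜ[ℤ] Additive.ofMul b}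

/-- The second Milnor `K`-group of a commutative ring, written additively. -/
abbrev MilnorK2 : Type u := (Additive Rˣ ⊗[ℤ] Additive Rˣ) ⧸ steinberg R

variable {R}

/-- The symbol `{a, b}`. -/
def milnorSymbol (a b : Rˣ) : MilnorK2 R :=
  QuotientAddGroup.mk (Additive.ofMul a ⊗ₜ[ℤ] Additive.ofMul b)

variable (k : Type v) (F : Type u) [Field k] [Field F] [Algebra k F] [Algebra R F]

/-- The logarithmic differential on the units of a ring with a map to `F`. -/
def dlogUnits : Additive Rˣ →+ Ω[F⁄k] where
  toFun a := dlogForm k F (algebraMap R F (a.toMul : R))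
  map_zero' := by simp [dlogForm]
  map_add' a b := by
    have ha : algebraMap R F (a.toMul : R) ≠ 0 := (a.toMul.isUnit.map (algebraMap R F)).ne_zero
    have hb : algebraMap R F (b.toMul : R) ≠ 0 := (b.toMul.isUnit.map (algebraMap R F)).ne_zero
    simp only [dlogForm, toMul_add, Units.val_mul, map_mul, Derivation.leibniz, smul_add, smul_smul]
    rw [add_comm]
    congr 2 <;> field_simp

/-- The map `a ⊗ b ↦ dlog a ∧ dlog b`. -/
def dlogTensor : Additive Rˣ ⊗[ℤ] Additive Rˣ →+ TwoForms k F :=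
  (TensorProduct.lift
    (((wedge k F).restrictScalars₁₂ ℤ ℤ).compl₁₂
      (dlogUnits (R := R) k F).toIntLinearMap
      (dlogUnits (R := R) k F).toIntLinearMap)).toAddMonoidHom

theorem steinberg_le_ker : steinberg R ≤ (dlogTensor (R := R) k F).ker := by
  rw [steinberg, AddSubgroup.closure_le]
  rintro _ ⟨a, b, hab, rfl⟩
  have h : algebraMap R F b = 1 - algebraMap R F a := by
    rw [← map_one (algebraMap R F), ← hab, map_add]; ring
  change wedge k F (dlogForm k F (algebraMap R F a)) (dlogForm k F (algebraMap R F b)) = 0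
  simp [dlogForm, h, wedge_self]

/-- The map `{a, b} ↦ dlog a ∧ dlog b` on Milnor `K₂`. -/
def dlogK2 : MilnorK2 R →+ TwoForms k F :=
  QuotientAddGroup.lift (steinberg R) (dlogTensor k F) (steinberg_le_ker k F)

end Milnor

/-! ### Curves and divisors -/

/-- A smooth complete (hence projective) integral curve over a field `K`. -/
structure SmoothCurve (K : Type u) [Field K] where
  /-- the underlying scheme -/
  C : Scheme.{u}
  /-- the structure morphism -/
  str : C ⟶ Spec (CommRingCat.of K)
  [integral : IsIntegral C]
  [smooth : SmoothOfRelativeDimension 1 str]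
  [proper : IsProper str]

attribute [instance] SmoothCurve.integral SmoothCurve.smooth SmoothCurve.proper

variable {k : Type v} {K : Type u} [Field k] [Field K] [Algebra k K]

namespace SmoothCurve

variable (X : SmoothCurve K)

/-- The structure map `K → K(C)` to the function field. -/
def fieldMap : K →+* X.C.functionField :=
  ((Scheme.ΓSpecIso (CommRingCat.of K)).inv ≫ X.str.appTop ≫
    X.C.presheaf.germ ⊤ (genericPoint X.C) trivial).hom

/-- The function field of the curve, as an algebra over the constant field `k`. -/
instance functionFieldAlgebra : Algebra k X.C.functionField :=
  (X.fieldMap.comp (algebraMap k K)).toAlgebra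

/-- The value in the function field of a section on a nonempty open set. -/
def rat {U : X.C.Opens} (hU : Nonempty U) : Γ(X.C, U) →+* X.C.functionField :=
  (X.C.germToFunctionField U (h := hU)).hom

/-- The local ring at `x`, as a subring of the function field. -/
def localRing (x : X.C) : Subring X.C.functionField :=
  (algebraMap (X.C.presheaf.stalk x) X.C.functionField).range

/-- The `n`-th power of the maximal ideal of the local ring at `x`. -/
abbrev maxPow (x : X.C) (n : ℕ) : Ideal (X.C.presheaf.stalk x) :=
  IsLocalRing.maximalIdeal (X.C.presheaf.stalk x) ^ n

end SmoothCurve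

/-- An effective divisor `𝓓 = ∑ mₓ x` on the curve whose support consists of `K`-rational points. -/
structure RationalDivisor (X : SmoothCurve K) where
  /-- the multiplicities -/
  mult : X.C →₀ ℕ
  rational : ∀ x ∈ mult.support,
    ∃ s : Spec (CommRingCat.of K) ⟶ X.C, s ≫ X.str = 𝟙 _ ∧ x ∈ Set.range s

/-! ### Absolute differential forms on the curve

All sheaves of forms are subsheaves of the constant sheaves of rational forms, i.e. of forms of
`K(C)` over `k`; such a sheaf is given by its stalks. -/

namespace SmoothCurve

variable (k) (X : SmoothCurve K)

/-- Rational absolute one-forms. -/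
abbrev Form1 : Type u := Ω[X.C.functionField⁄k]

/-- Rational absolute two-forms. -/
abbrev Form2 : Type u := TwoForms k X.C.functionField

variable {k} in
/-- The span, over the local ring at `x`, of the products of two one-forms in `M`. -/
def wedgeSpan {x : X.C} (M : Submodule (X.localRing x) (X.Form1 k)) :
    Submodule (X.localRing x) (X.Form2 k) :=
  Submodule.span (X.localRing x) {η | ∃ α ∈ M, ∃ β ∈ M, η = wedge k _ α β}

/-- The stalk at `x` of `Ω¹_C`. -/
def reg1 (x : X.C) : Submodule (X.localRing x) (X.Form1 k) :=
  Submodule.span (X.localRing x) {η | ∃ a ∈ X.localRing x, η = KaehlerDifferential.D k _ a}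

/-- The stalk at `x` of `Ω²_C`. -/
def reg2 (x : X.C) : Submodule (X.localRing x) (X.Form2 k) := X.wedgeSpan (X.reg1 k x)

variable {X}

/-- The stalk at `x` of `Ω¹_C⟨D⟩`, where `D` is the support of `𝓓`. -/
def log1 (𝓓 : RationalDivisor X) (x : X.C) : Submodule (X.localRing x) (X.Form1 k) :=
  Submodule.span (X.localRing x)
    ({η | ∃ a ∈ X.localRing x, η = KaehlerDifferential.D k _ a} ∪
      {η | 𝓓.mult x ≠ 0 ∧ ∃ a ∈ X.localRing x, a ≠ 0 ∧ η = dlogForm k _ a})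

/-- The stalk at `x` of `Ω²_C⟨D⟩`. -/
def log2 (𝓓 : RationalDivisor X) (x : X.C) : Submodule (X.localRing x) (X.Form2 k) :=
  X.wedgeSpan (log1 k 𝓓 x)

/-- `η` lies in the stalk at `x` of `Ω¹_C⟨D⟩(𝓓')`, where `𝓓' = 𝓓 - D`. -/
def IsPolar1 (𝓓 : RationalDivisor X) (x : X.C) (η : X.Form1 k) : Prop :=
  ∀ a ∈ X.maxPow x (𝓓.mult x - 1), algebraMap _ X.C.functionField a • η ∈ log1 k 𝓓 x

/-- The stalk at `x` of `Ω²_C⟨D⟩(𝓓')`, where `𝓓' = 𝓓 - D`. -/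
def polar2 (𝓓 : RationalDivisor X) (x : X.C) : AddSubgroup (X.Form2 k) where
  carrier := {η | ∀ a ∈ X.maxPow x (𝓓.mult x - 1),
    algebraMap _ X.C.functionField a • η ∈ log2 k 𝓓 x}
  zero_mem' a _ := by simp
  add_mem' h h' a ha := by rw [smul_add]; exact add_mem (h a ha) (h' a ha)
  neg_mem' h a ha := by rw [smul_neg]; exact neg_mem (h a ha)

/-- The sections over `U` of `Ω²_C⟨D⟩(𝓓')`. -/
def polarSections (𝓓 : RationalDivisor X) (U : X.C.Opens) : AddSubgroup (X.Form2 k) :=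
  ⨅ x ∈ U, polar2 k 𝓓 x

/-- The sections over `U` of the quotient sheaf `Ω²_C⟨D⟩(𝓓') / Ω²_C`: families of classes in the
quotients of the stalks that are locally induced by sections of `Ω²_C⟨D⟩(𝓓')`. -/
def principalParts (𝓓 : RationalDivisor X) (U : X.C.Opens) :
    AddSubgroup (∀ x : U, X.Form2 k ⧸ X.reg2 k x.1) where
  carrier := {q | ∀ x : U, ∃ V : X.C.Opens, x.1 ∈ V ∧ ∃ η ∈ polarSections k 𝓓 V,
    ∀ y : U, y.1 ∈ V → q y = (X.reg2 k y.1).mkQ η}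
  zero_mem' x := ⟨⊤, trivial, 0, zero_mem _, fun y _ => by simp⟩
  add_mem' := by
    intro p q hp hq x
    obtain ⟨V, hV, η, hη, h⟩ := hp x
    obtain ⟨V', hV', η', hη', h'⟩ := hq x
    refine ⟨V ⊓ V', ⟨hV, hV'⟩, η + η', ?_, fun y hy => ?_⟩
    · simp only [polarSections, AddSubgroup.mem_iInf] at hη hη' ⊢
      exact fun y hy => add_mem (hη y hy.1) (hη' y hy.2)
    · rw [Pi.add_apply, h y hy.1, h' y hy.2, map_add]
  neg_mem' := by
    intro q hq x
    obtain ⟨V, hV, η, hη, h⟩ := hq x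
    exact ⟨V, hV, -η, neg_mem hη, fun y hy => by rw [Pi.neg_apply, h y hy, map_neg]⟩

/-! ### The sheaf `𝒦₂` -/

variable (X) in
/-- The sections over `U` of the sheaf `𝒦₂` associated to Milnor `K₂`: families of elements of the
Milnor `K₂`-groups of the local rings that are locally given by sums of symbols. -/
def sheafK2 (U : X.C.Opens) : AddSubgroup (∀ x : U, MilnorK2 (X.C.presheaf.stalk x.1)) where
  carrier := {s | ∀ x : U, ∃ V : X.C.Opens, x.1 ∈ V ∧ ∃ l : List (Γ(X.C, V)ˣ × Γ(X.C, V)ˣ),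
    ∀ (y : U) (hy : y.1 ∈ V), s y = (l.map fun p => milnorSymbol
      (Units.map (X.C.presheaf.germ V y.1 hy).hom.toMonoidHom p.1)
      (Units.map (X.C.presheaf.germ V y.1 hy).hom.toMonoidHom p.2)).sum}
  zero_mem' x := ⟨⊤, trivial, [], fun y _ => by simp⟩
  add_mem' := by
    intro s t hs ht x
    obtain ⟨V, hV, l, h⟩ := hs x
    obtain ⟨V', hV', l', h'⟩ := ht x
    let ρ := Units.map (X.C.presheaf.map (homOfLE (inf_le_left : V ⊓ V' ≤ V)).op).hom.toMonoidHom
    let ρ' := Units.map (X.C.presheaf.map (homOfLE (inf_le_right : V ⊓ V' ≤ V')).op).hom.toMonoidHom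
    refine ⟨V ⊓ V', ⟨hV, hV'⟩, l.map (Prod.map ρ ρ) ++ l'.map (Prod.map ρ' ρ'), fun y hy => ?_⟩
    have e (u : Γ(X.C, V)ˣ) : Units.map (X.C.presheaf.germ (V ⊓ V') y.1 hy).hom.toMonoidHom (ρ u) =
        Units.map (X.C.presheaf.germ V y.1 hy.1).hom.toMonoidHom u := by
      ext
      exact X.C.presheaf.germ_res_apply (homOfLE inf_le_left) y.1 hy u.1
    have e' (u : Γ(X.C, V')ˣ) :
        Units.map (X.C.presheaf.germ (V ⊓ V') y.1 hy).hom.toMonoidHom (ρ' u) =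
        Units.map (X.C.presheaf.germ V' y.1 hy.2).hom.toMonoidHom u := by
      ext
      exact X.C.presheaf.germ_res_apply (homOfLE inf_le_right) y.1 hy u.1
    rw [Pi.add_apply, h y hy.1, h' y hy.2, List.map_append, List.sum_append, List.map_map,
      List.map_map]
    simp only [Function.comp_def, Prod.map, e, e']
  neg_mem' := by
    intro s hs x
    obtain ⟨V, hV, l, h⟩ := hs x
    refine ⟨V, hV, l.map fun p => (p.1⁻¹, p.2), fun y hy => ?_⟩
    rw [Pi.neg_apply, h y hy, List.map_map]
    have e {R : Type u} [CommRing R] (a b : Rˣ) : milnorSymbol a⁻¹ b = -milnorSymbol a b := by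
      simp [milnorSymbol, TensorProduct.neg_tmul]
    have e' (l : List (Γ(X.C, V)ˣ × Γ(X.C, V)ˣ)) (f : Γ(X.C, V)ˣ →* (X.C.presheaf.stalk y.1)ˣ) :
        (l.map fun p => milnorSymbol (f p.1⁻¹) (f p.2)).sum =
          -(l.map fun p => milnorSymbol (f p.1) (f p.2)).sum := by
      induction l with
      | nil => simp
      | cons p l ih =>
        rw [List.map_cons, List.sum_cons, ih, List.map_cons, List.sum_cons, map_inv, e, neg_add]
    exact (e' l _).symm

end SmoothCurve

/-! ### Čech hypercohomology of `𝒦₂ → Ω²_C⟨D⟩(𝓓') → Ω²_C⟨D⟩(𝓓') / Ω²_C` -/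

/-- An open covering of the curve by nonempty open sets. -/
structure Covering (X : SmoothCurve K) where
  /-- the index set -/
  I : Type u
  /-- the members -/
  U : I → X.C.Opens
  nonempty : ∀ i, Nonempty (U i)
  iSup_eq_top : ⨆ i, U i = ⊤

namespace Covering

variable {X : SmoothCurve K} (𝒰 : Covering X)

/-- The intersection of two members. -/
abbrev U₂ (i j : 𝒰.I) : X.C.Opens := 𝒰.U i ⊓ 𝒰.U j

/-- The intersection of three members. -/
abbrev U₃ (i j l : 𝒰.I) : X.C.Opens := 𝒰.U i ⊓ 𝒰.U j ⊓ 𝒰.U l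

variable (k)

/-- Families `(α, β)` of the shape of a Čech cochain of total degree one: `α i j` consists of
elements of the stalks of `𝒦₂` at the points of `U i ∩ U j`, and `β i` is a rational two-form. -/
abbrev Family1 : Type u :=
  (∀ i j, ∀ x : 𝒰.U₂ i j, MilnorK2 (X.C.presheaf.stalk x.1)) × (𝒰.I → X.Form2 k)

/-- Families `(a, b, c)` of the shape of a Čech cochain of total degree two. -/
abbrev Family2 : Type u :=
  (∀ i j l, ∀ x : 𝒰.U₃ i j l, MilnorK2 (X.C.presheaf.stalk x.1)) ×
    (𝒰.I → 𝒰.I → X.Form2 k) × (∀ i, ∀ x : 𝒰.U i, X.Form2 k ⧸ X.reg2 k x.1)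

variable {k} (𝓓 : RationalDivisor X)

/-- The Čech cochains of total degree one: `α ∈ C¹(𝒦₂)` and `β ∈ C⁰(Ω²_C⟨D⟩(𝓓'))`. -/
def cochains1 : AddSubgroup (𝒰.Family1 k) where
  carrier := {z | (∀ i j, z.1 i j ∈ X.sheafK2 (𝒰.U₂ i j)) ∧
    ∀ i, z.2 i ∈ SmoothCurve.polarSections k 𝓓 (𝒰.U i)}
  zero_mem' := ⟨fun _ _ => zero_mem _, fun _ => zero_mem _⟩
  add_mem' h h' := ⟨fun i j => add_mem (h.1 i j) (h'.1 i j), fun i => add_mem (h.2 i) (h'.2 i)⟩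
  neg_mem' h := ⟨fun i j => neg_mem (h.1 i j), fun i => neg_mem (h.2 i)⟩

/-- The Čech cochains of total degree two: `a ∈ C²(𝒦₂)`, `b ∈ C¹(Ω²_C⟨D⟩(𝓓'))` and
`c ∈ C⁰(Ω²_C⟨D⟩(𝓓') / Ω²_C)`. -/
def cochains2 : AddSubgroup (𝒰.Family2 k) where
  carrier := {z | (∀ i j l, z.1 i j l ∈ X.sheafK2 (𝒰.U₃ i j l)) ∧
    (∀ i j, z.2.1 i j ∈ SmoothCurve.polarSections k 𝓓 (𝒰.U₂ i j)) ∧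
    ∀ i, z.2.2 i ∈ SmoothCurve.principalParts k 𝓓 (𝒰.U i)}
  zero_mem' := ⟨fun _ _ _ => zero_mem _, fun _ _ => zero_mem _,
    fun i => zero_mem (SmoothCurve.principalParts k 𝓓 (𝒰.U i))⟩
  add_mem' h h' := ⟨fun i j l => add_mem (h.1 i j l) (h'.1 i j l),
    fun i j => add_mem (h.2.1 i j) (h'.2.1 i j), fun i => add_mem (h.2.2 i) (h'.2.2 i)⟩
  neg_mem' h := ⟨fun i j l => neg_mem (h.1 i j l), fun i j => neg_mem (h.2.1 i j),
    fun i => neg_mem (h.2.2 i)⟩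

/-- The total differential in degree one, `(α, β) ↦ (δα, dlog α - δβ, -β)`.

The signs in the total complex are those for which the total differential in degree two is
`(a, b, c) ↦ (δa, dlog a - δb, δc - b)`; any other choice of signs gives an isomorphic complex. -/
def IsCoboundaryOf (w : 𝒰.Family1 k) (z : 𝒰.Family2 k) : Prop :=
  (∀ i j l, ∀ x : 𝒰.U₃ i j l, z.1 i j l x =
    w.1 j l ⟨x.1, x.2.1.2, x.2.2⟩ - w.1 i l ⟨x.1, x.2.1.1, x.2.2⟩ + w.1 i j ⟨x.1, x.2.1⟩) ∧
  (∀ i j, ∀ x : 𝒰.U₂ i j, z.2.1 i j =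
    dlogK2 k X.C.functionField (w.1 i j x) - (w.2 j - w.2 i)) ∧
  ∀ i, ∀ x : 𝒰.U i, z.2.2 i x = -(X.reg2 k x.1).mkQ (w.2 i)

/-- The group of Čech cocycles of total degree two: cochains `(a, b, c)` such that `δa = 0`,
`δb = dlog a` and `δc` is the class of `b`. -/
def cocycles2 : AddSubgroup (𝒰.Family2 k) where
  carrier := {z | z ∈ 𝒰.cochains2 𝓓 ∧
    (∀ i j l m, ∀ x : (𝒰.U₃ i j l ⊓ 𝒰.U m : X.C.Opens),
      z.1 j l m ⟨x.1, ⟨x.2.1.1.2, x.2.1.2⟩, x.2.2⟩ - z.1 i l m ⟨x.1, ⟨x.2.1.1.1, x.2.1.2⟩, x.2.2⟩ +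
        z.1 i j m ⟨x.1, ⟨x.2.1.1.1, x.2.1.1.2⟩, x.2.2⟩ - z.1 i j l ⟨x.1, x.2.1⟩ = 0) ∧
    (∀ i j l, ∀ x : 𝒰.U₃ i j l,
      z.2.1 j l - z.2.1 i l + z.2.1 i j = dlogK2 k X.C.functionField (z.1 i j l x)) ∧
    ∀ i j, ∀ x : 𝒰.U₂ i j,
      z.2.2 j ⟨x.1, x.2.2⟩ - z.2.2 i ⟨x.1, x.2.1⟩ = (X.reg2 k x.1).mkQ (z.2.1 i j)}
  zero_mem' := ⟨zero_mem _, by simp, by simp, by simp⟩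
  add_mem' := by
    rintro z w ⟨h0, h1, h2, h3⟩ ⟨h0', h1', h2', h3'⟩
    refine ⟨add_mem h0 h0', fun i j l m x => ?_, fun i j l x => ?_, fun i j x => ?_⟩
    · have := congrArg₂ (· + ·) (h1 i j l m x) (h1' i j l m x)
      simp only [Prod.fst_add, Pi.add_apply, add_zero] at this ⊢
      rw [← this]; abel
    · have := congrArg₂ (· + ·) (h2 i j l x) (h2' i j l x)
      simp only [Prod.fst_add, Prod.snd_add, Pi.add_apply, map_add] at this ⊢
      rw [← this]; abel
    · have := congrArg₂ (· + ·) (h3 i j x) (h3' i j x)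
      simp only [Prod.fst_add, Prod.snd_add, Pi.add_apply, map_add] at this ⊢
      rw [← this]; abel
  neg_mem' := by
    rintro z ⟨h0, h1, h2, h3⟩
    refine ⟨neg_mem h0, fun i j l m x => ?_, fun i j l x => ?_, fun i j x => ?_⟩
    · have := congrArg (- ·) (h1 i j l m x)
      simp only [Prod.fst_neg, Pi.neg_apply, neg_zero] at this ⊢
      rw [← this]; abel
    · have := congrArg (- ·) (h2 i j l x)
      simp only [Prod.fst_neg, Prod.snd_neg, Pi.neg_apply, map_neg] at this ⊢
      rw [← this]; abel
    · have := congrArg (- ·) (h3 i j x)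
      simp only [Prod.fst_neg, Prod.snd_neg, Pi.neg_apply, map_neg] at this ⊢
      rw [← this]; abel

/-- `𝒱` refines `𝒰` through the map `ρ` of index sets. -/
def Refines (𝒰 𝒱 : Covering X) (ρ : 𝒱.I → 𝒰.I) : Prop := ∀ i, 𝒱.U i ≤ 𝒰.U (ρ i)

/-- The restriction of families along a refinement. -/
def restrict {𝒰 𝒱 : Covering X} {ρ : 𝒱.I → 𝒰.I} (h : Refines 𝒰 𝒱 ρ) (z : 𝒰.Family2 k) :
    𝒱.Family2 k :=
  (fun i j l x => z.1 (ρ i) (ρ j) (ρ l) ⟨x.1, ⟨h i x.2.1.1, h j x.2.1.2⟩, h l x.2.2⟩,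
    fun i j => z.2.1 (ρ i) (ρ j), fun i x => z.2.2 (ρ i) ⟨x.1, h i x.2⟩)

end Covering

namespace RationalDivisor

variable (k) {X : SmoothCurve K} (𝓓 : RationalDivisor X)

/-- Formal sums of Čech cocycles of total degree two, with respect to arbitrary coverings. -/
abbrev CocycleSums : Type (u + 1) := DirectSum (Covering X) fun 𝒰 => 𝒰.cocycles2 (k := k) 𝓓

variable {k} in
open scoped Classical in
/-- A cocycle as a formal sum. -/
def ofCocycle (𝒰 : Covering X) : 𝒰.cocycles2 (k := k) 𝓓 →+ 𝓓.CocycleSums k :=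
  DirectSum.of (fun 𝒰 : Covering X => 𝒰.cocycles2 (k := k) 𝓓) 𝒰

/-- The relations: coboundaries vanish, and a cocycle is identified with its restrictions to
refinements of the covering. -/
def cechRelations : AddSubgroup (𝓓.CocycleSums k) :=
  AddSubgroup.closure
    ({t | ∃ (𝒰 : Covering X) (z : 𝒰.cocycles2 (k := k) 𝓓),
        (∃ w ∈ 𝒰.cochains1 (k := k) 𝓓, 𝒰.IsCoboundaryOf w z.1) ∧ t = 𝓓.ofCocycle 𝒰 z} ∪
      {t | ∃ (𝒰 𝒱 : Covering X) (ρ : 𝒱.I → 𝒰.I) (h : Covering.Refines 𝒰 𝒱 ρ)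
        (z : 𝒰.cocycles2 (k := k) 𝓓) (z' : 𝒱.cocycles2 (k := k) 𝓓),
        z'.1 = Covering.restrict h z.1 ∧ t = 𝓓.ofCocycle 𝒱 z' - 𝓓.ofCocycle 𝒰 z})

/-- The hypercohomology group `ℍ²(C, 𝒦₂ → Ω²_C⟨D⟩(𝓓') → Ω²_C⟨D⟩(𝓓') / Ω²_C)`: the colimit, over
all open coverings, of the second cohomology groups of the total Čech complexes. On a noetherian
space of dimension one this is the derived-functor hypercohomology. -/
abbrev HyperH2 : Type (u + 1) := 𝓓.CocycleSums k ⧸ 𝓓.cechRelations k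

variable {k} in
/-- The class of a Čech cocycle. -/
def cechClass (𝒰 : Covering X) (z : 𝒰.cocycles2 (k := k) 𝓓) : 𝓓.HyperH2 k :=
  QuotientAddGroup.mk (𝓓.ofCocycle 𝒰 z)

end RationalDivisor

/-! ### Bundles, connections with poles, and trivializations along the divisor -/

namespace SmoothCurve

variable {X : SmoothCurve K}

/-- The restriction of a section to a smaller open set. -/
abbrev res (M : X.C.Modules) {U V : X.C.Opens} (h : V ≤ U) : Γ(M, U) →+ Γ(M, V) :=
  (M.presheaf.map (homOfLE h).op).hom

/-- The stalk of a sheaf of modules. -/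
abbrev stalk (M : X.C.Modules) (x : X.C) : Type u := ↑(M.presheaf.stalk x)

instance stalkModule (M : X.C.Modules) (x : X.C) : Module (X.C.presheaf.stalk x) (stalk M x) :=
  let N : PresheafOfModules (X.C.presheaf ⋙ forget₂ CommRingCat RingCat) := M.val
  inferInstanceAs (Module (X.C.presheaf.stalk x) ↑(TopCat.Presheaf.stalk N.presheaf x))

/-- The germ of a section. -/
abbrev germ (M : X.C.Modules) {U : X.C.Opens} (x : X.C) (hx : x ∈ U) : Γ(M, U) →+ stalk M x :=
  (M.presheaf.germ U x hx).hom

/-- The generic fibre, a vector space over the function field. -/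
abbrev genericFibre (M : X.C.Modules) : Type u := stalk M (genericPoint X.C)

instance genericFibreModule (M : X.C.Modules) : Module X.C.functionField (genericFibre M) :=
  stalkModule M (genericPoint X.C)

/-- The map from a stalk to the generic fibre. -/
def toGeneric (M : X.C.Modules) (x : X.C) : stalk M x →+ genericFibre M :=
  (M.presheaf.stalkSpecializes ((genericPoint_spec X.C).specializes trivial)).hom

/-- The value in the generic fibre of a section on a nonempty open set. -/
def generic (M : X.C.Modules) {U : X.C.Opens} (hU : Nonempty U) : Γ(M, U) →+ genericFibre M :=
  germ M (genericPoint X.C)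
    (((genericPoint_spec X.C).mem_open_set_iff U.isOpen).mpr (by simpa using hU))

/-- The sections `e` form a frame of `M` over `U`, i.e. they define an isomorphism `𝒪ʳ ≅ M` on
`U`. -/
def IsFrame (M : X.C.Modules) {r : ℕ} {U : X.C.Opens} (e : Fin r → Γ(M, U)) : Prop :=
  ∀ (V : X.C.Opens) (h : V ≤ U),
    Function.Bijective fun a : Fin r → Γ(X.C, V) => ∑ i, a i • res M h (e i)

/-- `M` is a vector bundle of rank `r`. -/
def IsBundle (M : X.C.Modules) (r : ℕ) : Prop :=
  ∀ x : X.C, ∃ U : X.C.Opens, x ∈ U ∧ ∃ e : Fin r → Γ(M, U), IsFrame M e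

end SmoothCurve

open SmoothCurve

/-- The stalk at `x` of `E ⊗ Ω¹_C⟨D⟩(𝓓')`, inside the rational one-forms with values in `E`. -/
def polarStalk {X : SmoothCurve K} (𝓓 : RationalDivisor X) (E : X.C.Modules) (x : X.C) :
    AddSubgroup (genericFibre E ⊗[X.C.functionField] X.Form1 k) :=
  AddSubgroup.closure
    {t | ∃ (s : stalk E x) (η : X.Form1 k), IsPolar1 k 𝓓 x η ∧ t = toGeneric E x s ⊗ₜ η}

variable (k) in
/-- A connection `∇ : E → E ⊗ Ω¹_C⟨D⟩(𝓓')`, relative to the constant field `k`. The sheaf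
`E ⊗ Ω¹_C⟨D⟩(𝓓')` is a subsheaf of the constant sheaf of rational one-forms with values in `E`. -/
structure PolarConnection {X : SmoothCurve K} (𝓓 : RationalDivisor X) (E : X.C.Modules) where
  /-- the action on sections -/
  app : ∀ {U : X.C.Opens}, Nonempty U →
    (Γ(E, U) →+ genericFibre E ⊗[X.C.functionField] X.Form1 k)
  app_res : ∀ {U V : X.C.Opens} (hU : Nonempty U) (hV : Nonempty V) (h : V ≤ U) (s : Γ(E, U)),
    app hV (res E h s) = app hU s
  leibniz : ∀ {U : X.C.Opens} (hU : Nonempty U) (f : Γ(X.C, U)) (s : Γ(E, U)),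
    app hU (f • s) = X.rat hU f • app hU s +
      generic E hU s ⊗ₜ KaehlerDifferential.D k X.C.functionField (X.rat hU f)
  app_mem : ∀ {U : X.C.Opens} (hU : Nonempty U) (s : Γ(E, U)), ∀ x ∈ U,
    app hU s ∈ polarStalk 𝓓 E x

section Trivialization

variable {X : SmoothCurve K} (𝓓 : RationalDivisor X) (E L : X.C.Modules)

/-- The fibre at `x` of `E|_𝓓`; the scheme `𝓓` is the disjoint union of the spectra of the rings
`𝒪_x / 𝔪_x ^ m_x`. -/
abbrev Along (x : X.C) (M : Type u) [AddCommGroup M] [Module (X.C.presheaf.stalk x) M] : Type u :=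
  M ⧸ (X.maxPow x (𝓓.mult x) • ⊤ : Submodule (X.C.presheaf.stalk x) M)

/-- A trivialization `g : E|_𝓓 ≅ E ⊗ L|_𝓓`. -/
abbrev TrivializationAlong : Type u :=
  ∀ x : X.C, Along 𝓓 x (stalk E x) ≃ₗ[X.C.presheaf.stalk x]
    Along 𝓓 x (stalk E x ⊗[X.C.presheaf.stalk x] stalk L x)

/-- The stalk at `x` of `E ⊗ L ⊗ Ω¹_C`, inside the rational one-forms with values in `E ⊗ L`. -/
def regularStalk (x : X.C) :
    AddSubgroup ((genericFibre E ⊗[X.C.functionField] genericFibre L)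
      ⊗[X.C.functionField] X.Form1 k) :=
  AddSubgroup.closure {t | ∃ (s : stalk E x) (l : stalk L x), ∃ η ∈ X.reg1 k x,
    t = (toGeneric E x s ⊗ₜ toGeneric L x l) ⊗ₜ η}

variable {𝓓 E L}

/-- The condition `[g, ∇|_𝓓] = 0`, where `∇|_𝓓` is the composite of `∇` with the projection to
`E ⊗ (Ω¹_C⟨D⟩(𝓓') / Ω¹_C)`. Both composites are evaluated on local sections `s` of `E`: if `∇ s`
is `∑ⱼ eⱼ ⊗ αⱼ`, and if `g s` and `g eⱼ` are `∑ₐ fₐ ⊗ lₐ` and `∑ₐ fₐ ⊗ l'ⱼₐ`, then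
`∑ₐ ∇ fₐ ⊗ lₐ` and `∑ⱼₐ fₐ ⊗ l'ⱼₐ ⊗ αⱼ` agree modulo regular forms. -/
def Commutes (nabla : PolarConnection k 𝓓 E) (g : TrivializationAlong 𝓓 E L) : Prop :=
  ∀ (x : X.C) (U : X.C.Opens) (hx : x ∈ U) (n m : ℕ) (s : Γ(E, U)) (e : Fin n → Γ(E, U))
    (α : Fin n → X.Form1 k) (f : Fin m → Γ(E, U)) (l : Fin m → Γ(L, U))
    (l' : Fin n → Fin m → Γ(L, U)),
    have hU : Nonempty U := ⟨⟨x, hx⟩⟩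
    (∀ j, IsPolar1 k 𝓓 x (α j)) →
    nabla.app hU s = ∑ j, generic E hU (e j) ⊗ₜ α j →
    g x (Submodule.Quotient.mk (germ E x hx s)) =
      Submodule.Quotient.mk (∑ a, germ E x hx (f a) ⊗ₜ germ L x hx (l a)) →
    (∀ j, g x (Submodule.Quotient.mk (germ E x hx (e j))) =
      Submodule.Quotient.mk (∑ a, germ E x hx (f a) ⊗ₜ germ L x hx (l' j a))) →
    (∑ a, LinearMap.rTensor (X.Form1 k)
        ((TensorProduct.mk X.C.functionField (genericFibre E) (genericFibre L)).flip
          (generic L hU (l a))) (nabla.app hU (f a))) -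
      (∑ j, ∑ a, (generic E hU (f a) ⊗ₜ generic L hU (l' j a)) ⊗ₜ α j) ∈ regularStalk E L x

end Trivialization

/-! ### Local data and the Čech cochain -/

/-- Choices of local data for a tuple `(E, L, ∇, 𝓓, g)`: a covering, local frames `eᵢ` of `E` and
`ℓᵢ` of `L`, liftings `μᵢ` of the local matrices of the trivialization, and the resulting
cocycles. -/
structure LocalData {X : SmoothCurve K} {𝓓 : RationalDivisor X} {E L : X.C.Modules} (r : ℕ)
    (nabla : PolarConnection k 𝓓 E) (g : TrivializationAlong 𝓓 E L) where
  /-- the covering -/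
  cov : Covering X
  /-- the frames of `E` -/
  e : ∀ i, Fin r → Γ(E, cov.U i)
  isFrame_e : ∀ i, IsFrame E (e i)
  /-- the generators of `L` -/
  ell : ∀ i, Γ(L, cov.U i)
  isFrame_ell : ∀ i, IsFrame L (fun _ : Fin 1 => ell i)
  /-- the cocycle of `E`, with `eᵢ = cᵢⱼ eⱼ` -/
  c : ∀ i j, GL (Fin r) Γ(X.C, cov.U₂ i j)
  c_spec : ∀ i j a, res E inf_le_left (e i a) = ∑ b, c i j a b • res E inf_le_right (e j b)
  /-- the cocycle of `L`, with `ℓᵢ = λᵢⱼ ℓⱼ` -/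
  lam : ∀ i j, Γ(X.C, cov.U₂ i j)ˣ
  lam_spec : ∀ i j, res L inf_le_left (ell i) =
    (lam i j : Γ(X.C, cov.U₂ i j)) • res L inf_le_right (ell j)
  /-- the matrices of the connection, with `∇ eᵢ = ωᵢ eᵢ` -/
  ω : cov.I → Matrix (Fin r) (Fin r) (X.Form1 k)
  ω_polar : ∀ i a b, ∀ x ∈ cov.U i, IsPolar1 k 𝓓 x (ω i a b)
  ω_spec : ∀ i a, nabla.app (cov.nonempty i) (e i a) =
    ∑ b, generic E (cov.nonempty i) (e i b) ⊗ₜ ω i a b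
  /-- liftings of the matrices of the trivialization, which on `𝓓` identifies `μᵢ eᵢ` with
  `eᵢ ⊗ ℓᵢ`; so `μᵢ = cᵢⱼ μⱼ cᵢⱼ⁻¹ λᵢⱼ` along `𝓓` -/
  μ : ∀ i, GL (Fin r) Γ(X.C, cov.U i)
  μ_spec : ∀ i a x, ∀ hx : x ∈ cov.U i,
    g x (Submodule.Quotient.mk (germ E x hx (∑ b, μ i a b • e i b))) =
      Submodule.Quotient.mk (germ E x hx (e i a) ⊗ₜ germ L x hx (ell i))

namespace LocalData

variable {X : SmoothCurve K} {𝓓 : RationalDivisor X} {E L : X.C.Modules} {r : ℕ}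
  {nabla : PolarConnection k 𝓓 E} {g : TrivializationAlong 𝓓 E L} (d : LocalData r nabla g)

/-- Two members of the covering meet, since the curve is irreducible. -/
theorem nonempty₂ (i j : d.cov.I) : Nonempty (d.cov.U₂ i j) := by
  have h : ∀ m, ((d.cov.U m : Set X.C)).Nonempty :=
    fun m => Set.nonempty_coe_sort.mp (d.cov.nonempty m)
  exact Set.nonempty_coe_sort.mpr
    (nonempty_preirreducible_inter (d.cov.U i).isOpen (d.cov.U j).isOpen (h i) (h j))

/-- The form `dlog λᵢⱼ`. -/
def dlogLam (i j : d.cov.I) : X.Form1 k :=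
  dlogForm k X.C.functionField (X.rat (d.nonempty₂ i j) (d.lam i j))

/-- The form `Tr(dμᵢ μᵢ⁻¹ ∧ ωᵢ)`. -/
def traceForm (i : d.cov.I) : X.Form2 k :=
  ∑ a, ∑ b, ∑ t, wedge k X.C.functionField
    (X.rat (d.cov.nonempty i) ((d.μ i)⁻¹ b t) •
      KaehlerDifferential.D k X.C.functionField (X.rat (d.cov.nonempty i) (d.μ i a b)))
    (d.ω i t a)

/-- The family `({λᵢⱼ, det cⱼₗ}, dlog λᵢⱼ ∧ Tr ωⱼ, Tr(-dμᵢ μᵢ⁻¹ ∧ ωᵢ))`. -/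
def cochain : d.cov.Family2 k :=
  (fun i j l x => milnorSymbol
      (Units.map (X.C.presheaf.germ (d.cov.U₂ i j) x.1 x.2.1).hom.toMonoidHom (d.lam i j))
      (Units.map (X.C.presheaf.germ (d.cov.U₂ j l) x.1 ⟨x.2.1.2, x.2.2⟩).hom.toMonoidHom
        (Matrix.GeneralLinearGroup.det (d.c j l))),
    fun i j => wedge k X.C.functionField (d.dlogLam i j) (d.ω j).trace,
    fun i x => (X.reg2 k x.1).mkQ (-d.traceForm i))

end LocalData

end

/-! The heart of the matter is a computation at a point of an overlap. Put `T_i = Tr(dμ_i μ_i⁻¹ ∧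
ω_i)`, `c = c_ij`, `λ = λ_ij`. Since `g` is linear and frames are bases of the stalks, `μ_i` agrees
along the divisor with `ν = λ c μ_j c⁻¹` (`ratM_sub_mem`). Replacing `μ_i` by `ν` changes `T_i` only
by a regular form, because a function vanishing along the divisor makes a polar form regular,
whether one multiplies by the function or wedges with its differential (`smul_polar1_mem_reg1`,
`D_wedge_polar1_mem_reg2`). Now expand `dν ν⁻¹` and insert the gauge formula `ω_i = dc c⁻¹ + c ω_j
c⁻¹`. The result is `T_j + dlog λ ∧ Tr ω_j`, plus a product of regular forms, minus `Tr(c⁻¹ dc ∧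
(μ_j⁻¹ ω_j μ_j - ω_j))`. This last trace is regular because `g` commutes with the polar part of the
connection (`commutator_mem_reg1`). The outcome is `trace_change_frame`, that is, `δc = b` modulo
regular forms. The relation `δb = dlog a` comes from the trace of the gauge formula, `Tr ω_j - Tr
ω_l = dlog det c_jl` (`trace_sub_trace`), and `δa = 0` from bilinearity of symbols and
multiplicativity of `λ` and `det c`. The facts about polar forms rest on a uniformizer at each point
of the divisor. It exists because the curve is smooth of relative dimension one and the point is
rational (`isPrincipal_maximalIdeal`). For independence, two systems of choices are merged into one
on the disjoint union of the coverings. The merged cocycle restricts to each of the given ones, so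
all three have the same class in the colimit and no coboundary has to be written down. For
existence, the matrix of `g` is lifted at one point at a time, on a neighbourhood avoiding the other
points of the divisor (`exists_chart`). -/

noncomputable section

/-! ### Matrices of differentials -/

section MatrixForms

variable {F : Type*} [Field F] {Λ : Type*} [Ring Λ] [Algebra F Λ] {r : ℕ}

/-- A matrix of scalars as a matrix over an algebra. -/
abbrev scalarMatrix (Λ : Type*) [Ring Λ] [Algebra F Λ] (A : Matrix (Fin r) (Fin r) F) :
    Matrix (Fin r) (Fin r) Λ := A.map (algebraMap F Λ)

theorem scalarMatrix_mul (A B : Matrix (Fin r) (Fin r) F) :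
    scalarMatrix Λ (A * B) = scalarMatrix Λ A * scalarMatrix Λ B := Matrix.map_mul

theorem scalarMatrix_one : scalarMatrix Λ (1 : Matrix (Fin r) (Fin r) F) = 1 :=
  Matrix.map_one _ (map_zero _) (map_one _)

/-- Cyclicity of the trace fails over the noncommutative `Λ`, but it survives when one factor is
scalar, since scalars are central. -/
theorem trace_scalarMatrix_mul (A : Matrix (Fin r) (Fin r) F) (B : Matrix (Fin r) (Fin r) Λ) :
    (scalarMatrix Λ A * B).trace = (B * scalarMatrix Λ A).trace := by
  simp only [Matrix.trace, Matrix.diag, Matrix.mul_apply, Matrix.map_apply]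
  rw [Finset.sum_comm]
  exact Finset.sum_congr rfl fun i _ => Finset.sum_congr rfl fun j _ => Algebra.commutes _ _

theorem trace_scalarMatrix_conj {A B : Matrix (Fin r) (Fin r) F} (h : B * A = 1)
    (N : Matrix (Fin r) (Fin r) Λ) :
    (scalarMatrix Λ A * N * scalarMatrix Λ B).trace = N.trace := by
  rw [mul_assoc, trace_scalarMatrix_mul, mul_assoc, ← scalarMatrix_mul, h, scalarMatrix_one,
    mul_one]

variable (d : F →+ Λ)

theorem map_one_eq_zero_of_leibniz (hd : ∀ a b, d (a * b) = a • d b + b • d a) : d 1 = 0 := by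
  simpa using hd 1 1

/-- Scalars are central in `Λ`, so the entrywise Leibniz rule can be arranged in the order of the
matrix product. -/
theorem map_mul_of_leibniz (hd : ∀ a b, d (a * b) = a • d b + b • d a)
    (A B : Matrix (Fin r) (Fin r) F) :
    (A * B).map d = A.map d * scalarMatrix Λ B + scalarMatrix Λ A * B.map d := by
  ext i j
  simp only [Matrix.map_apply, Matrix.mul_apply, Matrix.add_apply, map_sum, hd,
    Finset.sum_add_distrib, Algebra.smul_def, Algebra.commutes (B _ _)]
  rw [add_comm]

/-- Differentiate `A * B = 1` and multiply on the left by `B`. -/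
theorem map_inv_of_leibniz (hd : ∀ a b, d (a * b) = a • d b + b • d a)
    {A B : Matrix (Fin r) (Fin r) F} (h : B * A = 1) (h' : A * B = 1) :
    B.map d = -(scalarMatrix Λ B * A.map d * scalarMatrix Λ B) := by
  have h1 := map_mul_of_leibniz d hd A B
  have h0 : (1 : Matrix (Fin r) (Fin r) F).map d = 0 := by
    ext i j
    by_cases e : i = j <;> simp [e, map_one_eq_zero_of_leibniz d hd]
  rw [h', h0] at h1
  have h2 := congrArg (scalarMatrix Λ B * ·) h1
  simp only [mul_zero, mul_add, ← mul_assoc, ← scalarMatrix_mul, h, scalarMatrix_one,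
    one_mul] at h2
  exact (neg_eq_of_add_eq_zero_right h2.symm).symm

/-- The trace of `dA A⁻¹` is the logarithmic differential of the determinant. -/
theorem trace_map_mul_inv (hd : ∀ a b, d (a * b) = a • d b + b • d a)
    (A : Matrix (Fin r) (Fin r) F) (hA : A.det ≠ 0) :
    (A.map d * scalarMatrix Λ A⁻¹).trace = A.det⁻¹ • d A.det := by
  have dlog_mul {a b : F} (ha : a ≠ 0) (hb : b ≠ 0) :
      (a * b)⁻¹ • d (a * b) = a⁻¹ • d a + b⁻¹ • d b := by
    rw [hd, smul_add, smul_smul, smul_smul, add_comm]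
    congr 2 <;> field_simp
  -- Both sides turn products of invertible matrices into sums, so it suffices to treat diagonal
  -- matrices and transvections.
  refine Matrix.diagonal_transvection_induction_of_det_ne_zero (fun A =>
    (A.map d * scalarMatrix Λ A⁻¹).trace = A.det⁻¹ • d A.det) A hA ?_ ?_ ?_
  · intro D hD
    have hD' : ∀ i, D i ≠ 0 := by simpa [Finset.prod_eq_zero_iff] using hD
    have hinv : (Matrix.diagonal D)⁻¹ = Matrix.diagonal fun i => (D i)⁻¹ := by
      refine Matrix.inv_eq_right_inv ?_
      rw [Matrix.diagonal_mul_diagonal, ← Matrix.diagonal_one]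
      congr 1
      ext i
      exact mul_inv_cancel₀ (hD' i)
    have key : ∀ s : Finset (Fin r),
        (∏ i ∈ s, D i)⁻¹ • d (∏ i ∈ s, D i) = ∑ i ∈ s, (D i)⁻¹ • d (D i) := by
      intro s
      induction s using Finset.induction_on with
      | empty => simp [map_one_eq_zero_of_leibniz d hd]
      | insert a s ha ih =>
        rw [Finset.prod_insert ha, Finset.sum_insert ha,
          dlog_mul (hD' a) (Finset.prod_ne_zero_iff.mpr fun i _ => hD' i), ih]
    rw [hinv, Matrix.det_diagonal, key]
    simp [Matrix.trace, Algebra.smul_def, Algebra.commutes]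
  · intro t
    rw [Matrix.TransvectionStruct.det, map_one_eq_zero_of_leibniz d hd, smul_zero]
    have hinv : (t.toMatrix)⁻¹ = t.inv.toMatrix :=
      Matrix.inv_eq_left_inv t.inv_mul
    rw [hinv]
    have h1 : t.toMatrix.map d = Matrix.single t.i t.j (d t.c) := by
      ext a b
      by_cases e : a = b <;>
      simp [Matrix.TransvectionStruct.toMatrix, Matrix.transvection, e,
        Matrix.single_apply, map_one_eq_zero_of_leibniz d hd, apply_ite d]
    -- The differential of a transvection sits at the entry `(i, j)`, so the trace only sees the
    -- entry `(j, i)` of the inverse, which vanishes as `i ≠ j`.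
    have h2 : scalarMatrix Λ t.inv.toMatrix t.j t.i = 0 := by
      simp [Matrix.TransvectionStruct.toMatrix, Matrix.transvection,
        Matrix.TransvectionStruct.inv, t.hij, t.hij.symm]
    rw [h1, Matrix.trace_single_mul, h2]
    simp
  · intro A B hA hB ihA ihB
    have hA' : IsUnit A.det := hA.isUnit
    have hB' : IsUnit B.det := hB.isUnit
    rw [Matrix.det_mul, dlog_mul hA hB, ← ihA, ← ihB, map_mul_of_leibniz d hd,
      Matrix.mul_inv_rev, scalarMatrix_mul, add_mul, Matrix.trace_add]
    congr 1
    · rw [mul_assoc, ← mul_assoc (scalarMatrix Λ B), ← scalarMatrix_mul,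
        Matrix.mul_nonsing_inv _ hB', scalarMatrix_one, one_mul]
    · rw [← mul_assoc, mul_assoc (scalarMatrix Λ A)]
      exact trace_scalarMatrix_conj (Matrix.nonsing_inv_mul _ hA') _


/-- All entries of the matrix lie in the given subgroup. -/
def HasEntriesIn {G : Type*} [AddGroup G] (S : AddSubgroup G) (A : Matrix (Fin r) (Fin r) G) :
    Prop := ∀ i j, A i j ∈ S

/-- The matrices with entries in a subring and their differentials, for subgroups `R₁`, `R₂` and
`P` of regular one-forms, regular two-forms and polar one-forms, and `J` the ideal of the polar
divisor. -/
structure FormFiltration (d : F →+ Λ) (O : Subring F) (J : AddSubgroup F)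
    (R₁ R₂ P : AddSubgroup Λ) : Prop where
  leibniz : ∀ a b, d (a * b) = a • d b + b • d a
  smul_R₁ : ∀ a ∈ O, ∀ x ∈ R₁, a • x ∈ R₁
  smul_P : ∀ a ∈ O, ∀ x ∈ P, a • x ∈ P
  mul_mem : ∀ x ∈ R₁, ∀ y ∈ R₁, x * y ∈ R₂
  d_mem : ∀ a ∈ O, d a ∈ R₁
  smul_J : ∀ a ∈ J, ∀ x ∈ P, a • x ∈ R₁
  d_J_mul : ∀ a ∈ J, ∀ x ∈ P, d a * x ∈ R₂

namespace FormFiltration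

variable {d} {O : Subring F} {J : AddSubgroup F} {R₁ R₂ P : AddSubgroup Λ}
  {A B : Matrix (Fin r) (Fin r) F} {N N' : Matrix (Fin r) (Fin r) Λ}

/-- The subgroups are left free so that one lemma serves for `O` acting on `R₁` and on `P`, and for
`J` carrying `P` into `R₁`. -/
theorem scalar_mul {S T : AddSubgroup Λ} {I : AddSubgroup F} (h : ∀ a ∈ I, ∀ x ∈ S, a • x ∈ T)
    (hA : HasEntriesIn I A) (hN : HasEntriesIn S N) : HasEntriesIn T (scalarMatrix Λ A * N) := by
  intro i j
  rw [Matrix.mul_apply]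
  refine sum_mem fun t _ => ?_
  have := h _ (hA i t) _ (hN t j)
  rwa [Algebra.smul_def] at this

theorem mul_scalar {S T : AddSubgroup Λ} {I : AddSubgroup F} (h : ∀ a ∈ I, ∀ x ∈ S, a • x ∈ T)
    (hA : HasEntriesIn I A) (hN : HasEntriesIn S N) : HasEntriesIn T (N * scalarMatrix Λ A) := by
  intro i j
  rw [Matrix.mul_apply]
  refine sum_mem fun t _ => ?_
  have := h _ (hA t j) _ (hN i t)
  rwa [Algebra.smul_def, Algebra.commutes] at this

theorem trace_mul {S T U : AddSubgroup Λ} (h : ∀ x ∈ S, ∀ y ∈ T, x * y ∈ U)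
    (hN : HasEntriesIn S N) (hN' : HasEntriesIn T N') : (N * N').trace ∈ U := by
  rw [Matrix.trace]
  refine sum_mem fun i _ => ?_
  rw [Matrix.diag_apply, Matrix.mul_apply]
  exact sum_mem fun t _ => h _ (hN _ _) _ (hN' _ _)

variable (h : FormFiltration d O J R₁ R₂ P)
include h

/-- Changing a matrix modulo `J` changes the trace form by a regular form. -/
theorem trace_sub_mem_of_sub_mem {A A' B B' : Matrix (Fin r) (Fin r) F}
    {ω : Matrix (Fin r) (Fin r) Λ}
    (hA' : HasEntriesIn O.toAddSubgroup A')
    (hB' : HasEntriesIn O.toAddSubgroup B')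
    (hBA : B * B' = 1) (hA : A' * A = 1)
    (hAB : HasEntriesIn J (A - B)) (hω : HasEntriesIn P ω) (hBB : HasEntriesIn R₁ (B.map d)) :
    (A.map d * scalarMatrix Λ A' * ω).trace - (B.map d * scalarMatrix Λ B' * ω).trace ∈ R₂ := by
  -- The resolvent identity: the inverses differ by a multiple of `A - B`.
  have e1 : A' - B' = -(A' * ((A - B) * B')) := by
    rw [sub_mul, hBA, mul_sub, ← mul_assoc, hA]; simp
  -- Each of the two terms contains `A - B`: in the first its differential meets a polar form, in
  -- the second it multiplies one.
  have e2 : A.map d * scalarMatrix Λ A' * ω - B.map d * scalarMatrix Λ B' * ω =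
      (A - B).map d * (scalarMatrix Λ A' * ω) -
        B.map d * (scalarMatrix Λ A' * (scalarMatrix Λ (A - B) * (scalarMatrix Λ B' * ω))) := by
    have e3 : (A - B).map d = A.map d - B.map d := by ext; simp
    have e4 : scalarMatrix Λ A' = scalarMatrix Λ B' + scalarMatrix Λ (A' - B') := by
      ext; simp
    have e5 : scalarMatrix Λ (A' - B') =
        -(scalarMatrix Λ A' * scalarMatrix Λ (A - B) * scalarMatrix Λ B') := by
      rw [e1, ← scalarMatrix_mul, ← scalarMatrix_mul, mul_assoc]
      ext
      exact map_neg (algebraMap F Λ) _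
    rw [e3, sub_mul]
    have e6 : B.map d * scalarMatrix Λ A' * ω =
      B.map d * scalarMatrix Λ B' * ω - B.map d * (scalarMatrix Λ A' *
        (scalarMatrix Λ (A - B) * (scalarMatrix Λ B' * ω))) := by
      conv_lhs => rw [e4, e5]
      noncomm_ring
    rw [← mul_assoc, ← mul_assoc (B.map d), e6]
    noncomm_ring
  rw [← Matrix.trace_sub, e2, Matrix.trace_sub]
  refine sub_mem ?_ ?_
  · refine trace_mul (S := J.map d) (T := P) ?_ ?_ (scalar_mul h.smul_P hA' hω)
    · rintro _ ⟨a, ha, rfl⟩ x hx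
      exact h.d_J_mul a ha x hx
    · exact fun i j => ⟨_, hAB i j, rfl⟩
  · exact trace_mul h.mul_mem hBB (scalar_mul h.smul_R₁ hA'
      (scalar_mul h.smul_J hAB (scalar_mul h.smul_P hB' hω)))

omit h in
theorem entries_mul (hA : HasEntriesIn O.toAddSubgroup A) (hB : HasEntriesIn O.toAddSubgroup B) :
    HasEntriesIn O.toAddSubgroup (A * B) := fun i j => by
  rw [Matrix.mul_apply]
  exact sum_mem fun t _ => O.mul_mem (hA _ _) (hB _ _)

theorem entries_map (hA : HasEntriesIn O.toAddSubgroup A) : HasEntriesIn R₁ (A.map d) :=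
  fun i j => h.d_mem _ (hA i j)

/-- The trace form for a matrix conjugated, along the divisor, by the change of frame and
multiplied by a unit. -/
theorem trace_change_frame {c c' m m' n n' : Matrix (Fin r) (Fin r) F} {l l' : F}
    {ω ω' : Matrix (Fin r) (Fin r) Λ}
    (hc : HasEntriesIn O.toAddSubgroup c) (hc' : HasEntriesIn O.toAddSubgroup c')
    (hm : HasEntriesIn O.toAddSubgroup m) (hm' : HasEntriesIn O.toAddSubgroup m')
    (hn' : HasEntriesIn O.toAddSubgroup n') (hl : l ∈ O) (hl' : l' ∈ O)
    (hcc : c * c' = 1) (hmm : m * m' = 1) (hnn : n' * n = 1) (hll : l * l' = 1)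
    (hω : HasEntriesIn P ω)
    (hn : HasEntriesIn J (n - l • (c * m * c')))
    (hgauge : ω * scalarMatrix Λ c = c.map d + scalarMatrix Λ c * ω')
    (hcomm : HasEntriesIn R₁ (scalarMatrix Λ m' * ω' - ω' * scalarMatrix Λ m')) :
    (n.map d * scalarMatrix Λ n' * ω).trace - (m.map d * scalarMatrix Λ m' * ω').trace -
      (l' • d l) * ω'.trace ∈ R₂ := by
  have hcc' : c' * c = 1 := mul_eq_one_comm.mp hcc
  have hmm' : m' * m = 1 := mul_eq_one_comm.mp hmm
  have hsm {A : Matrix (Fin r) (Fin r) F} {a : F} (ha : a ∈ O)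
      (hA : HasEntriesIn O.toAddSubgroup A) : HasEntriesIn O.toAddSubgroup (a • A) :=
    fun i j => O.mul_mem ha (hA i j)
  have hν := hsm hl (entries_mul (entries_mul hc hm) hc')
  have hν' := hsm hl' (entries_mul (entries_mul hc hm') hc')
  have hνν : (l • (c * m * c')) * (l' • (c * m' * c')) = 1 := by
    rw [smul_mul_smul_comm, hll, one_smul]
    calc c * m * c' * (c * m' * c') = c * m * (c' * c) * m' * c' := by noncomm_ring
      _ = c * (m * m') * c' := by rw [hcc']; noncomm_ring
      _ = 1 := by rw [hmm, mul_one, hcc]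
  -- From here on `n` may be replaced by `ν = l • (c * m * c')`, with inverse `l' • (c * m' * c')`.
  have key := h.trace_sub_mem_of_sub_mem hn' hν' hνν hnn hn hω (h.entries_map hν)
  set C := scalarMatrix Λ c
  set C' := scalarMatrix Λ c'
  set M := scalarMatrix Λ m
  set M' := scalarMatrix Λ m'
  have hCC : C * C' = 1 := by rw [← scalarMatrix_mul, hcc, scalarMatrix_one]
  have hCC' : C' * C = 1 := by rw [← scalarMatrix_mul, hcc', scalarMatrix_one]
  have hMM : M * M' = 1 := by rw [← scalarMatrix_mul, hmm, scalarMatrix_one]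
  have hdc' : c'.map d = -(C' * c.map d * C') := map_inv_of_leibniz d h.leibniz hcc' hcc
  have hωeq : ω = c.map d * C' + C * ω' * C' := by
    calc ω = ω * C * C' := by rw [mul_assoc, hCC, mul_one]
      _ = _ := by rw [hgauge, add_mul]
  -- The four terms of `dν ν⁻¹` come from differentiating `l`, `c`, `m` and `c⁻¹` in turn.
  have hdν : (l • (c * m * c')).map d * scalarMatrix Λ (l' • (c * m' * c')) =
      (l' • d l) • (1 : Matrix (Fin r) (Fin r) Λ) + c.map d * C' + C * (m.map d * M') * C' -
        C * (M * C' * c.map d * M') * C' := by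
    have e1 : (l • (c * m * c')).map d = (d l) • (C * M * C') + l • (c * m * c').map d := by
      ext i j
      have : (C * M * C') i j = algebraMap F Λ ((c * m * c') i j) := by
        rw [← scalarMatrix_mul, ← scalarMatrix_mul]; rfl
      simp only [Matrix.map_apply, Matrix.smul_apply, Matrix.add_apply, this, smul_eq_mul,
        h.leibniz]
      rw [← Algebra.commutes, ← Algebra.smul_def, add_comm]
    have e2 : scalarMatrix Λ (l' • (c * m' * c')) = l' • (C * M' * C') := by
      rw [← scalarMatrix_mul, ← scalarMatrix_mul]
      ext
      exact (map_mul (algebraMap F Λ) _ _).trans (Algebra.smul_def _ _).symm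
    have e3 : (c * m * c').map d = c.map d * M * C' + C * m.map d * C' -
        C * M * C' * c.map d * C' := by
      rw [map_mul_of_leibniz d h.leibniz, map_mul_of_leibniz d h.leibniz, hdc',
        scalarMatrix_mul]
      noncomm_ring
    have e4 : C * M * C' * (C * M' * C') = 1 := by
      calc C * M * C' * (C * M' * C') = C * M * (C' * C) * M' * C' := by noncomm_ring
        _ = C * (M * M') * C' := by rw [hCC']; noncomm_ring
        _ = 1 := by rw [hMM, mul_one, hCC]
    have e5 : (c.map d * M * C' + C * m.map d * C' - C * M * C' * c.map d * C') *
        (C * M' * C') = c.map d * C' + C * (m.map d * M') * C' -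
        C * (M * C' * c.map d * M') * C' := by
      calc _ = c.map d * M * (C' * C) * M' * C' + C * m.map d * (C' * C) * M' * C' -
            C * M * C' * c.map d * (C' * C) * M' * C' := by noncomm_ring
        _ = c.map d * (M * M') * C' + C * (m.map d * M') * C' -
            C * (M * C' * c.map d * M') * C' := by rw [hCC']; noncomm_ring
        _ = _ := by rw [hMM, mul_one]
    rw [e1, e2, add_mul, smul_mul_smul_comm, e3, hll, one_smul, e5]
    rw [mul_smul_comm, smul_mul_assoc, e4, smul_assoc]
    abel
  have hcd := h.entries_map hc
  have hreg : HasEntriesIn R₁ (c.map d * C') := mul_scalar h.smul_R₁ hc' hcd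
  have hdreg : HasEntriesIn R₁
      ((l • (c * m * c')).map d * scalarMatrix Λ (l' • (c * m' * c'))) :=
    mul_scalar h.smul_R₁ hν' (h.entries_map hν)
  -- What remains is visibly regular: `dν ν⁻¹` times the regular part `dc c⁻¹` of `ω`, and `c⁻¹ dc`
  -- times the commutator of `m⁻¹` with `ω'`.
  have hsplit : ((l • (c * m * c')).map d * scalarMatrix Λ (l' • (c * m' * c')) * ω).trace -
      (m.map d * M' * ω').trace - (l' • d l) * ω'.trace =
      ((l • (c * m * c')).map d * scalarMatrix Λ (l' • (c * m' * c')) * (c.map d * C')).trace -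
        (C' * c.map d * ((M' * ω' - ω' * M') * M)).trace := by
    have t1 : ((l • (c * m * c')).map d * scalarMatrix Λ (l' • (c * m' * c')) *
        (C * ω' * C')).trace = (l' • d l) * ω'.trace + (C' * c.map d * ω').trace +
        (m.map d * M' * ω').trace - (C' * c.map d * M' * ω' * M).trace := by
      rw [hdν]
      have : ((l' • d l) • (1 : Matrix (Fin r) (Fin r) Λ) + c.map d * C' +
          C * (m.map d * M') * C' - C * (M * C' * c.map d * M') * C') * (C * ω' * C') =
          (l' • d l) • (C * ω' * C') + C * (C' * c.map d * ω') * C' +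
            C * (m.map d * M' * ω') * C' - C * (M * (C' * c.map d * M' * ω')) * C' := by
        calc _ = (l' • d l) • (C * ω' * C') + c.map d * (C' * C) * ω' * C' +
            C * (m.map d * M') * (C' * C) * ω' * C' -
            C * (M * C' * c.map d * M') * (C' * C) * ω' * C' := by
              rw [sub_mul, add_mul, add_mul, smul_mul_assoc, one_mul]; noncomm_ring
          _ = (l' • d l) • (C * ω' * C') + (C * C') * c.map d * ω' * C' +
            C * (m.map d * M') * ω' * C' -
            C * (M * C' * c.map d * M') * ω' * C' := by rw [hCC', hCC]; noncomm_ring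
          _ = _ := by noncomm_ring
      rw [this, Matrix.trace_sub, Matrix.trace_add, Matrix.trace_add, Matrix.trace_smul,
        trace_scalarMatrix_conj hcc', trace_scalarMatrix_conj hcc', trace_scalarMatrix_conj hcc',
        trace_scalarMatrix_conj hcc', trace_scalarMatrix_mul, smul_eq_mul]
    -- The terms from differentiating `c` and `c⁻¹` cancel up to `m⁻¹ ω' m - ω'`, which is the
    -- commutator times `m`.
    have t2 : (C' * c.map d * ((M' * ω' - ω' * M') * M)).trace =
        (C' * c.map d * M' * ω' * M).trace - (C' * c.map d * ω').trace := by
      rw [← Matrix.trace_sub]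
      have hMM' : M' * M = 1 := by rw [← scalarMatrix_mul, hmm', scalarMatrix_one]
      congr 1
      calc _ = C' * c.map d * M' * ω' * M - C' * c.map d * ω' * (M' * M) := by noncomm_ring
        _ = _ := by rw [hMM', mul_one]
    conv_lhs => rw [hωeq]
    rw [mul_add, Matrix.trace_add, t1, t2]
    abel
  have hreg2 := sub_mem (trace_mul h.mul_mem hdreg hreg)
    (trace_mul h.mul_mem (scalar_mul h.smul_R₁ hc' hcd) (mul_scalar h.smul_R₁ hm hcomm))
  rw [← hsplit] at hreg2
  convert add_mem key hreg2 using 1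
  abel

end FormFiltration

end MatrixForms

/-! ### The local ring at a rational point -/

section RationalPoint

/-- The maximal ideal of a noetherian local ring `R` is principal, if `R` is a localization of an
algebra with cyclic module of differentials, and its residue field lifts to the constants. -/
theorem isPrincipal_maximalIdeal_of_span_kaehler {A S R K : Type*} [CommRing A] [CommRing S]
    [CommRing R] [Field K] [IsLocalRing R] [IsNoetherianRing R] [Algebra A S] [Algebra S R]
    [Algebra A R] [IsScalarTower A S R] (p : Ideal S) [p.IsPrime] [IsLocalization.AtPrime R p]
    (ω : Ω[S⁄A]) (hω : Submodule.span S {ω} = ⊤) (σ : R →+* K) (κ : K →+* R)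
    (hσκ : ∀ a, σ (κ a) = a) (hA : ∀ a : A, algebraMap A R a ∈ κ.range) :
    (IsLocalRing.maximalIdeal R).IsPrincipal := by
  set m := IsLocalRing.maximalIdeal R with hm
  have hker : RingHom.ker σ = m := by
    have : (RingHom.ker σ).IsMaximal :=
      RingHom.ker_isMaximal_of_surjective σ fun a => ⟨κ a, hσκ a⟩
    exact IsLocalRing.eq_maximalIdeal this
  have hsub (f : R) : f - κ (σ f) ∈ m := by
    rw [← hker, RingHom.mem_ker, map_sub, hσκ, sub_self]
  have hfix (a : A) : κ (σ (algebraMap A R a)) = algebraMap A R a := by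
    obtain ⟨b, hb⟩ := hA a
    rw [← hb, hσκ]
  -- The derivation sends `f` to the class of `f - f(x)` in `m / m²`, where `f(x)` is the value
  -- under `σ`, viewed as a constant through `κ`. It is linear over `A` because elements of `A`
  -- become constants.
  let δ₀ : S →ₗ[A] m.Cotangent :=
    { toFun f := m.toCotangent ⟨_, hsub (algebraMap S R f)⟩
      map_add' f g := by
        rw [← map_add]
        congr 1
        ext
        simp only [map_add, Submodule.coe_add]
        ring
      map_smul' a f := by
        rw [RingHom.id_apply, ← algebraMap_smul R a (m.toCotangent _), ← map_smul]
        congr 1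
        ext
        simp only [Algebra.smul_def, map_mul, Submodule.coe_smul, Algebra.algebraMap_self_apply,
          ← IsScalarTower.algebraMap_apply A S R, hfix]
        ring }
  let δ : Derivation A S m.Cotangent := Derivation.mk' δ₀ fun f g => by
    change m.toCotangent _ = f • m.toCotangent _ + g • m.toCotangent _
    rw [← algebraMap_smul R f, ← algebraMap_smul R g, ← map_smul, ← map_smul, ← map_add,
      Ideal.toCotangent_eq]
    simp only [Submodule.coe_add, Submodule.coe_smul, smul_eq_mul, map_mul]
    -- The defect in the Leibniz rule is `-(f - f(x)) (g - g(x))`, which lies in `m²`.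
    rw [pow_two, show ∀ a b c d : R, a * b - c * d - (a * (b - d) + b * (a - c)) =
      -((a - c) * (b - d)) by intros; ring]
    exact neg_mem (Ideal.mul_mem_mul (hsub _) (hsub _))
  have hspan (f : S) : δ f ∈ Submodule.span R {δ.liftKaehlerDifferential ω} := by
    have : KaehlerDifferential.D A S f ∈ Submodule.span S {ω} := hω ▸ trivial
    obtain ⟨c, hc⟩ := Submodule.mem_span_singleton.mp this
    rw [← δ.liftKaehlerDifferential_comp_D, ← hc, map_smul, ← algebraMap_smul R c]
    exact Submodule.smul_mem _ _ (Submodule.mem_span_singleton_self _)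
  obtain ⟨t, ht⟩ := m.toCotangent_surjective (δ.liftKaehlerDifferential ω)
  -- By Nakayama it is enough that the lift `t` of the image of the generator `ω` generates `m`
  -- modulo `m²`. Elements of `m` come from `S` after clearing a denominator that is a unit in `R`.
  have hle : m ≤ Ideal.span {(t : R)} := by
    refine Submodule.le_of_le_smul_of_le_jacobson_bot (IsNoetherian.noetherian m)
      (IsLocalRing.maximalIdeal_le_jacobson ⊥) ?_
    intro x hx
    obtain ⟨⟨a, s⟩, has⟩ := IsLocalization.surj p.primeCompl x
    have hs : IsUnit (algebraMap S R s) := IsLocalization.map_units R s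
    have ha : algebraMap S R a ∈ m := by rw [← has]; exact Ideal.mul_mem_right _ _ hx
    have h1 : δ a = m.toCotangent ⟨_, ha⟩ := by
      change m.toCotangent _ = _
      congr 2
      rw [← hker, RingHom.mem_ker] at ha
      rw [ha, map_zero, sub_zero]
    obtain ⟨c, hc⟩ := Submodule.mem_span_singleton.mp (hspan a)
    rw [← ht, h1, ← map_smul, Ideal.toCotangent_eq] at hc
    have h2 : algebraMap S R a ∈ Ideal.span {(t : R)} ⊔ m • m := by
      have := sub_mem (Ideal.mul_mem_left (Ideal.span {(t : R)} ⊔ m • m) c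
        (Submodule.mem_sup_left (Ideal.mem_span_singleton_self _)))
        (Submodule.mem_sup_right (S := Ideal.span {(t : R)}) (by
          rw [smul_eq_mul, ← pow_two]; exact hc))
      simpa using this
    rw [← has] at h2
    exact (Ideal.mul_unit_mem_iff_mem _ hs).mp h2
  have heq : m = Ideal.span {(t : R)} :=
    le_antisymm hle ((Ideal.span_singleton_le_iff_mem _).mpr t.2)
  exact ⟨⟨t, heq⟩⟩

variable {K : Type u} [Field K] (X : SmoothCurve K)

namespace SmoothCurve

instance : IsLocallyNoetherian X.C := by
  have : Smooth X.str := SmoothOfRelativeDimension.smooth 1 X.str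
  exact LocallyOfFiniteType.isLocallyNoetherian X.str

/-- The maximal ideal at a rational point of a smooth curve is principal. -/
theorem isPrincipal_maximalIdeal (x : X.C) (s : Spec (CommRingCat.of K) ⟶ X.C)
    (hs : s ≫ X.str = 𝟙 _) (hx : x ∈ Set.range s) :
    (IsLocalRing.maximalIdeal (X.C.presheaf.stalk x)).IsPrincipal := by
  obtain ⟨y, rfl⟩ := hx
  obtain rfl : y = IsLocalRing.closedPoint (CommRingCat.of K) :=
    Subsingleton.elim (α := PrimeSpectrum K) _ _
  set x := s (IsLocalRing.closedPoint (CommRingCat.of K))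
  obtain ⟨U, hU, V, hV, hxV, e, h⟩ :=
    SmoothOfRelativeDimension.exists_isStandardSmoothOfRelativeDimension (n := 1) (f := X.str) x
  -- The base is a single point, so the affine open set supplied by smoothness is all of it.
  have hUtop : U = ⊤ := by
    refine top_le_iff.mp fun y _ => ?_
    rw [Subsingleton.elim (α := PrimeSpectrum K) y (X.str x)]
    exact e hxV
  subst hUtop
  have hxtop : x ∈ (⊤ : X.C.Opens) := Opens.mem_top x
  let κ : CommRingCat.of K ⟶ X.C.presheaf.stalk x :=
    (Scheme.ΓSpecIso (CommRingCat.of K)).inv ≫ X.str.appTop ≫ X.C.presheaf.germ ⊤ x hxtop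
  -- Evaluation at the rational point splits the inclusion of the constants, because `s` is a
  -- section of the structure morphism.
  have hσκ : κ ≫ Scheme.stalkClosedPointTo s = 𝟙 _ := by
    have h1 := Scheme.germ_stalkClosedPointTo s ⊤ hxtop
    have h2 : X.str.appTop ≫ s.appTop = 𝟙 _ := by
      rw [← Scheme.Hom.comp_appTop, hs, Scheme.Hom.id_appTop]
    have h3 : (Spec (CommRingCat.of K)).presheaf.mapIso
        (eqToIso (Scheme.preimage_eq_top_of_closedPoint_mem s hxtop).symm).op = Iso.refl _ := by
      ext1
      exact (Spec (CommRingCat.of K)).presheaf.map_id _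
    rw [h3] at h1
    replace h1 := h1.trans (congrArg (s.app ⊤ ≫ ·)
      (Category.id_comp (Scheme.ΓSpecIso (CommRingCat.of K)).hom))
    refine (?_ : _ = (Scheme.ΓSpecIso (CommRingCat.of K)).inv ≫ X.str.appTop ≫
      (X.C.presheaf.germ ⊤ x hxtop ≫ Scheme.stalkClosedPointTo s)).trans
      ((congrArg (fun f => (Scheme.ΓSpecIso (CommRingCat.of K)).inv ≫ X.str.appTop ≫ f) h1).trans
        ?_)
    · simp only [κ, Category.assoc]
    · refine (congrArg (fun f => (Scheme.ΓSpecIso (CommRingCat.of K)).inv ≫ f)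
        ((Category.assoc _ _ _).symm.trans (congrArg
          (· ≫ (Scheme.ΓSpecIso (CommRingCat.of K)).hom) h2))).trans ?_
      rw [Category.id_comp, Iso.inv_hom_id]
  have hA : ∀ a, ∃ b, κ.hom b = X.C.presheaf.germ V x hxV ((X.str.appLE ⊤ V e).hom a) := by
    intro a
    refine ⟨(Scheme.ΓSpecIso (CommRingCat.of K)).hom.hom a, ?_⟩
    have h1 : (Scheme.ΓSpecIso (CommRingCat.of K)).hom ≫ κ =
        X.str.appLE ⊤ V e ≫ X.C.presheaf.germ V x hxV := by
      simp only [κ, Iso.hom_inv_id_assoc, Scheme.Hom.appLE, Category.assoc]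
      rw [TopCat.Presheaf.germ_res]
      rfl
    exact congrArg (fun f => f.hom a) h1
  let := (X.str.appLE ⊤ V e).hom.toAlgebra
  let := (X.C.presheaf.germ V x hxV).hom.toAlgebra
  let := ((X.C.presheaf.germ V x hxV).hom.comp (X.str.appLE ⊤ V e).hom).toAlgebra
  have : IsScalarTower Γ(Spec (CommRingCat.of K), ⊤) Γ(X.C, V) (X.C.presheaf.stalk x) :=
    .of_algebraMap_eq fun _ => rfl
  have hloc : IsLocalization.AtPrime (X.C.presheaf.stalk x)
    (hV.primeIdealOf ⟨x, hxV⟩).asIdeal := hV.isLocalization_stalk ⟨x, hxV⟩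
  have hsm : Algebra.IsStandardSmoothOfRelativeDimension 1 Γ(Spec (CommRingCat.of K), ⊤)
    Γ(X.C, V) := h
  have hne : Nonempty V := ⟨⟨x, hxV⟩⟩
  have hrank := Algebra.IsStandardSmoothOfRelativeDimension.rank_kaehlerDifferential
    (R := Γ(Spec (CommRingCat.of K), ⊤)) (S := Γ(X.C, V)) 1
  have hss : Algebra.IsStandardSmooth Γ(Spec (CommRingCat.of K), ⊤) Γ(X.C, V) :=
    hsm.isStandardSmooth
  -- Relative dimension one makes the differentials free of rank one, hence cyclic.
  obtain ⟨ω, hω⟩ := (rank_le_one_iff (K := Γ(X.C, V))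
    (V := Ω[Γ(X.C, V)⁄Γ(Spec (CommRingCat.of K), ⊤)])).mp hrank.le
  exact isPrincipal_maximalIdeal_of_span_kaehler (A := Γ(Spec (CommRingCat.of K), ⊤))
    (S := Γ(X.C, V)) (hV.primeIdealOf ⟨x, hxV⟩).asIdeal ω
    (top_le_iff.mp fun η _ => Submodule.mem_span_singleton.mpr (hω η))
    (Scheme.stalkClosedPointTo s).hom κ.hom (fun a => congrArg (fun f => f.hom a) hσκ) hA

end SmoothCurve

end RationalPoint

/-! ### Regular, logarithmic and polar forms at a point -/

section LocalForms

variable {k : Type v} {K : Type u} [Field k] [Field K] [Algebra k K]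

/-- Passing to the exterior algebra turns wedges of one-forms into products in a ring, where the
matrix identities apply. -/
theorem coe_wedge (F : Type u) [Field F] [Algebra k F] (a b : Ω[F⁄k]) :
    (wedge k F a b : ExteriorAlgebra F Ω[F⁄k]) =
      ExteriorAlgebra.ι F a * ExteriorAlgebra.ι F b := by
  change ((exteriorPower.ιMulti F 2 ![a, b] : ⋀[F]^2 Ω[F⁄k]) : ExteriorAlgebra F Ω[F⁄k]) = _
  rw [exteriorPower.ιMulti_apply_coe, ExteriorAlgebra.ιMulti_apply]
  simp

theorem dlogForm_mul {F : Type u} [Field F] [Algebra k F] {a b : F} (ha : a ≠ 0) (hb : b ≠ 0) :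
    dlogForm k F (a * b) = dlogForm k F a + dlogForm k F b := by
  simp only [dlogForm, Derivation.leibniz, smul_add, smul_smul]
  rw [add_comm]
  congr 2 <;> field_simp

theorem dlogForm_pow {F : Type u} [Field F] [Algebra k F] {a : F} (ha : a ≠ 0) (n : ℕ) :
    dlogForm k F (a ^ n) = n • dlogForm k F a := by
  induction n with
  | zero => simp [dlogForm]
  | succ n ih => rw [pow_succ, dlogForm_mul (pow_ne_zero n ha) ha, ih, succ_nsmul]

namespace SmoothCurve

variable {X : SmoothCurve K} {x : X.C}

theorem algebraMap_mem_localRing (a : X.C.presheaf.stalk x) :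
    algebraMap _ X.C.functionField a ∈ X.localRing x := ⟨a, rfl⟩

theorem smul_mem_of_mem {M : Type*} [AddCommGroup M] [Module X.C.functionField M]
    (N : Submodule (X.localRing x) M) {a : X.C.functionField} (ha : a ∈ X.localRing x) {η : M}
    (hη : η ∈ N) : a • η ∈ N :=
  N.smul_mem (⟨a, ha⟩ : X.localRing x) hη

theorem D_mem_reg1 {a : X.C.functionField} (ha : a ∈ X.localRing x) :
    KaehlerDifferential.D k _ a ∈ X.reg1 k x :=
  Submodule.subset_span ⟨a, ha, rfl⟩

theorem dlog_mem_reg1 {a : X.C.functionField} (ha : a ∈ X.localRing x)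
    (ha' : a⁻¹ ∈ X.localRing x) : dlogForm k _ a ∈ X.reg1 k x :=
  smul_mem_of_mem _ ha' (D_mem_reg1 ha)

theorem wedge_mem_wedgeSpan {M : Submodule (X.localRing x) (X.Form1 k)} {α β : X.Form1 k}
    (hα : α ∈ M) (hβ : β ∈ M) : wedge k _ α β ∈ X.wedgeSpan M :=
  Submodule.subset_span ⟨α, hα, β, hβ, rfl⟩

theorem reg1_le_log1 (𝓓 : RationalDivisor X) (x : X.C) : X.reg1 k x ≤ log1 k 𝓓 x :=
  Submodule.span_mono Set.subset_union_left

variable (k) in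
/-- The stalk at `x` of `Ω¹_C⟨D⟩(𝓓')`. -/
def polar1 (𝓓 : RationalDivisor X) (x : X.C) : AddSubgroup (X.Form1 k) where
  carrier := {η | IsPolar1 k 𝓓 x η}
  zero_mem' a _ := by simp
  add_mem' h h' a ha := by rw [smul_add]; exact add_mem (h a ha) (h' a ha)
  neg_mem' h a ha := by rw [smul_neg]; exact neg_mem (h a ha)

variable {𝓓 : RationalDivisor X}

theorem smul_mem_polar1 {a : X.C.functionField} (ha : a ∈ X.localRing x) {η : X.Form1 k}
    (hη : η ∈ polar1 k 𝓓 x) : a • η ∈ polar1 k 𝓓 x := fun b hb => by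
  rw [smul_comm]
  exact smul_mem_of_mem _ ha (hη b hb)

theorem wedge_mem_polar2 {α β : X.Form1 k} (hα : α ∈ X.reg1 k x) (hβ : β ∈ polar1 k 𝓓 x) :
    wedge k _ α β ∈ polar2 k 𝓓 x := fun a ha => by
  rw [← map_smul]
  exact wedge_mem_wedgeSpan (reg1_le_log1 𝓓 x hα) (hβ a ha)

theorem log1_eq_reg1 (h : 𝓓.mult x = 0) : log1 k 𝓓 x = X.reg1 k x := by
  simp [log1, reg1, h]

/-- At a point of the support of the divisor, an element of the local ring is a unit times a power
of a uniformizer. -/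
theorem exists_uniformizer (h : 𝓓.mult x ≠ 0) : ∃ t : X.C.presheaf.stalk x,
    IsLocalRing.maximalIdeal (X.C.presheaf.stalk x) = Ideal.span {t} ∧
      ∀ a : X.C.presheaf.stalk x, a ≠ 0 → ∃ (n : ℕ) (w : (X.C.presheaf.stalk x)ˣ),
        a = t ^ n * w := by
  obtain ⟨s, hs, hx⟩ := 𝓓.rational x (Finsupp.mem_support_iff.mpr h)
  have hp := X.isPrincipal_maximalIdeal x s hs hx
  obtain ⟨t, ht⟩ := hp.principal
  refine ⟨t, ht, fun a ha => ?_⟩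
  obtain ⟨n, hn⟩ := exists_maximalIdeal_pow_eq_of_principal _ hp (Ideal.span {a})
    (by simpa using ha)
  rw [ht, Ideal.submodule_span_eq, Ideal.span_singleton_pow,
    Ideal.span_singleton_eq_span_singleton] at hn
  obtain ⟨w, hw⟩ := hn.symm
  exact ⟨n, w, hw.symm⟩

theorem units_mem (w : (X.C.presheaf.stalk x)ˣ) :
    (algebraMap _ X.C.functionField (w : X.C.presheaf.stalk x))⁻¹ ∈ X.localRing x :=
  ⟨(w⁻¹ : (X.C.presheaf.stalk x)ˣ), by rw [map_units_inv]⟩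

theorem algebraMap_ne_zero {a : X.C.presheaf.stalk x} (ha : a ≠ 0) :
    algebraMap _ X.C.functionField a ≠ 0 := by
  rwa [Ne, FaithfulSMul.algebraMap_eq_zero_iff]

/-- To check a statement about logarithmic forms at a point of the divisor, it suffices to consider
regular forms and the logarithmic differential of a uniformizer. -/
theorem log1_induction {t : X.C.presheaf.stalk x}
    (ht : ∀ a : X.C.presheaf.stalk x, a ≠ 0 → ∃ (n : ℕ) (w : (X.C.presheaf.stalk x)ˣ),
        a = t ^ n * w)
    {N : Submodule (X.localRing x) (X.Form1 k)} (h : X.reg1 k x ≤ N)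
    (h' : dlogForm k _ (algebraMap _ X.C.functionField t) ∈ N) : log1 k 𝓓 x ≤ N := by
  refine Submodule.span_le.mpr ?_
  rintro η (⟨a, ha, rfl⟩ | ⟨-, a, ⟨a, rfl⟩, ha0, rfl⟩)
  · exact h (D_mem_reg1 ha)
  · have ha0' : a ≠ 0 := by rintro rfl; simp at ha0
    obtain ⟨n, w, rfl⟩ := ht a ha0'
    have hw : dlogForm k _ (algebraMap _ X.C.functionField (w : X.C.presheaf.stalk x)) ∈ N :=
      h (dlog_mem_reg1 (algebraMap_mem_localRing _) (units_mem w))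
    -- The exponent zero is separated because `t ≠ 0` is only known when a positive power of `t`
    -- divides a nonzero element.
    rcases Nat.eq_zero_or_pos n with rfl | hn
    · simpa using hw
    · have ht0 : t ≠ 0 := by rintro rfl; simp [hn.ne'] at ha0'
      rw [map_mul, map_pow, SetLike.mem_coe, dlogForm_mul (pow_ne_zero n (algebraMap_ne_zero ht0))
        (algebraMap_ne_zero w.ne_zero), dlogForm_pow (algebraMap_ne_zero ht0)]
      exact add_mem (nsmul_mem h' n) hw

/-- A logarithmic pole is simple: with `a = t b` one has `t b · dt/t = b dt`. -/
theorem smul_log1_mem_reg1 (h : 𝓓.mult x ≠ 0) {a : X.C.presheaf.stalk x}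
    (ha : a ∈ IsLocalRing.maximalIdeal (X.C.presheaf.stalk x)) {η : X.Form1 k}
    (hη : η ∈ log1 k 𝓓 x) : algebraMap _ X.C.functionField a • η ∈ X.reg1 k x := by
  obtain ⟨t, hm, ht⟩ := exists_uniformizer h
  rw [hm, Ideal.mem_span_singleton] at ha
  obtain ⟨b, rfl⟩ := ha
  let a' : X.localRing x := ⟨_, algebraMap_mem_localRing (t * b)⟩
  refine log1_induction (𝓓 := 𝓓) ht (N := (X.reg1 k x).comap (LinearMap.lsmul _ _ a'))
    (fun η hη => Submodule.smul_mem _ a' hη) ?_ hη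
  change algebraMap _ X.C.functionField (t * b) • dlogForm k _ _ ∈ X.reg1 k x
  by_cases ht0 : t = 0
  · subst ht0; simp
  · rw [dlogForm, smul_smul, map_mul, mul_assoc, mul_comm, mul_assoc,
      inv_mul_cancel₀ (algebraMap_ne_zero ht0), mul_one]
    exact smul_mem_of_mem _ (algebraMap_mem_localRing b) (D_mem_reg1 (algebraMap_mem_localRing t))

/-- With `a = t b`, the term `b dt ∧ dt/t` vanishes and `t db ∧ dt/t = db ∧ dt` has no pole. -/
theorem D_wedge_log1_mem_reg2 (h : 𝓓.mult x ≠ 0) {a : X.C.presheaf.stalk x}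
    (ha : a ∈ IsLocalRing.maximalIdeal (X.C.presheaf.stalk x)) {η : X.Form1 k}
    (hη : η ∈ log1 k 𝓓 x) :
    wedge k _ (KaehlerDifferential.D k _ (algebraMap _ X.C.functionField a)) η ∈ X.reg2 k x := by
  obtain ⟨t, hm, ht⟩ := exists_uniformizer h
  rw [hm, Ideal.mem_span_singleton] at ha
  obtain ⟨b, rfl⟩ := ha
  refine log1_induction (𝓓 := 𝓓) ht (N := (X.reg2 k x).comap
    ((wedge k _ (KaehlerDifferential.D k _
      (algebraMap _ X.C.functionField (t * b)))).restrictScalars (X.localRing x))) (fun η hη => wedge_mem_wedgeSpan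
        (D_mem_reg1 (algebraMap_mem_localRing _)) hη) ?_ hη
  change wedge k _ (KaehlerDifferential.D k _ (algebraMap _ X.C.functionField (t * b)))
    (dlogForm k _ _) ∈ X.reg2 k x
  by_cases ht0 : t = 0
  · subst ht0; simp [dlogForm]
  · rw [dlogForm, map_smul, map_mul, Derivation.leibniz, map_add, map_smul, map_smul,
      LinearMap.add_apply, LinearMap.smul_apply, LinearMap.smul_apply, wedge_self, smul_zero,
      add_zero, smul_smul, inv_mul_cancel₀ (algebraMap_ne_zero ht0), one_smul]
    exact wedge_mem_wedgeSpan (D_mem_reg1 (algebraMap_mem_localRing _))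
      (D_mem_reg1 (algebraMap_mem_localRing _))

/-- Truncated subtraction makes the exponent `0 - 1` equal to zero, so `1` is an allowed multiplier,
and there are no logarithmic generators off the support. -/
theorem mem_reg1_of_mem_polar1 (h : 𝓓.mult x = 0) {η : X.Form1 k} (hη : η ∈ polar1 k 𝓓 x) :
    η ∈ X.reg1 k x := by
  have := hη 1 (by simp [h])
  rwa [map_one, one_smul, log1_eq_reg1 h] at this

/-- The product of a polar form with a function vanishing along the divisor is regular. -/
theorem smul_polar1_mem_reg1 {a : X.C.presheaf.stalk x} (ha : a ∈ X.maxPow x (𝓓.mult x))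
    {η : X.Form1 k} (hη : η ∈ polar1 k 𝓓 x) :
    algebraMap _ X.C.functionField a • η ∈ X.reg1 k x := by
  by_cases h : 𝓓.mult x = 0
  · exact smul_mem_of_mem _ (algebraMap_mem_localRing a) (mem_reg1_of_mem_polar1 h hη)
  · rw [maxPow, ← Nat.sub_add_cancel (Nat.one_le_iff_ne_zero.mpr h), pow_succ] at ha
    refine Submodule.mul_induction_on ha (fun b hb c hc => ?_) fun b c hb hc => ?_
    · rw [mul_comm, map_mul, mul_smul]
      exact smul_log1_mem_reg1 h hc (hη b hb)
    · rw [map_add, add_smul]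
      exact add_mem hb hc

/-- The product of a polar form with the differential of a function vanishing along the divisor is
regular. -/
theorem D_wedge_polar1_mem_reg2 {a : X.C.presheaf.stalk x} (ha : a ∈ X.maxPow x (𝓓.mult x))
    {η : X.Form1 k} (hη : η ∈ polar1 k 𝓓 x) :
    wedge k _ (KaehlerDifferential.D k _ (algebraMap _ X.C.functionField a)) η ∈ X.reg2 k x := by
  by_cases h : 𝓓.mult x = 0
  · exact wedge_mem_wedgeSpan (D_mem_reg1 (algebraMap_mem_localRing a))
      (mem_reg1_of_mem_polar1 h hη)
  · have ha' := ha
    obtain ⟨t, hm, ht⟩ := exists_uniformizer h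
    have htm : t ∈ IsLocalRing.maximalIdeal (X.C.presheaf.stalk x) :=
      hm ▸ Ideal.mem_span_singleton_self t
    rw [maxPow, hm, Ideal.span_singleton_pow, Ideal.mem_span_singleton] at ha'
    obtain ⟨b, rfl⟩ := ha'
    -- With `m = mult x`, `d(t^m b) = t^m db + m b t^(m-1) dt`. In the first term `t^m` makes `η`
    -- regular; in the second `t^(m-1) η` is logarithmic and its product with `dt` is regular.
    rw [map_mul, Derivation.leibniz, map_add, LinearMap.add_apply, map_smul, map_smul,
      LinearMap.smul_apply, LinearMap.smul_apply, map_pow, Derivation.leibniz_pow]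
    refine add_mem ?_ (smul_mem_of_mem _ (algebraMap_mem_localRing b) ?_)
    · rw [← map_smul, ← map_pow]
      exact wedge_mem_wedgeSpan (D_mem_reg1 (algebraMap_mem_localRing b))
        (smul_polar1_mem_reg1 (Ideal.pow_mem_pow htm _) hη)
    · rw [map_nsmul, map_smul, LinearMap.smul_apply, LinearMap.smul_apply, ← map_smul, ← map_pow]
      exact nsmul_mem (D_wedge_log1_mem_reg2 h htm (hη _ (Ideal.pow_mem_pow htm _))) _

/-! ### The filtration on rational forms at a point -/

variable (k X) in
/-- The algebra of rational absolute forms. -/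
abbrev Forms : Type u := ExteriorAlgebra X.C.functionField (X.Form1 k)

variable (k X) in
/-- The inclusion of one-forms. -/
def form1Incl : X.Form1 k →+ X.Forms k := (ExteriorAlgebra.ι X.C.functionField).toAddMonoidHom

variable (k X) in
/-- The inclusion of two-forms. -/
def form2Incl : X.Form2 k →+ X.Forms k :=
  (Submodule.subtype (⋀[X.C.functionField]^2 (X.Form1 k))).toAddMonoidHom

theorem form2Incl_wedge (α β : X.Form1 k) :
    form2Incl k X (wedge k _ α β) = form1Incl k X α * form1Incl k X β := coe_wedge _ α β

theorem form2Incl_injective : Function.Injective (form2Incl k X) := Subtype.val_injective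

variable (k X) in
/-- The differential of rational functions, in the algebra of forms. -/
def formD : X.C.functionField →+ X.Forms k :=
  (form1Incl k X).comp (KaehlerDifferential.D k X.C.functionField : _ →+ _)

variable (k 𝓓 x) in
/-- The functions at `x` that vanish along the divisor. -/
def vanishing : AddSubgroup X.C.functionField :=
  (X.maxPow x (𝓓.mult x)).toAddSubgroup.map (algebraMap _ X.C.functionField).toAddMonoidHom

theorem form1Incl_smul (a : X.C.functionField) (η : X.Form1 k) :
    form1Incl k X (a • η) = a • form1Incl k X η := map_smul (ExteriorAlgebra.ι _) a η

/-- The bridge from the geometry to the abstract matrix computation. The pole order enters only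
through the fields `smul_J` and `d_J_mul`. -/
theorem formFiltration (𝓓 : RationalDivisor X) (x : X.C) :
    FormFiltration (formD k X) (X.localRing x) (vanishing x 𝓓)
      ((X.reg1 k x).toAddSubgroup.map (form1Incl k X))
      ((X.reg2 k x).toAddSubgroup.map (form2Incl k X))
      ((polar1 k 𝓓 x).map (form1Incl k X)) where
  leibniz a b := by
    change form1Incl k X (KaehlerDifferential.D k _ (a * b)) = _
    rw [Derivation.leibniz, map_add, form1Incl_smul, form1Incl_smul]
    rfl
  smul_R₁ := by
    rintro a ha _ ⟨η, hη, rfl⟩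
    exact ⟨a • η, smul_mem_of_mem _ ha hη, form1Incl_smul a η⟩
  smul_P := by
    rintro a ha _ ⟨η, hη, rfl⟩
    exact ⟨a • η, smul_mem_polar1 ha hη, form1Incl_smul a η⟩
  mul_mem := by
    rintro _ ⟨α, hα, rfl⟩ _ ⟨β, hβ, rfl⟩
    exact ⟨wedge k _ α β, wedge_mem_wedgeSpan hα hβ, form2Incl_wedge α β⟩
  d_mem a ha := ⟨_, D_mem_reg1 ha, rfl⟩
  smul_J := by
    rintro _ ⟨a, ha, rfl⟩ _ ⟨η, hη, rfl⟩
    exact ⟨_, smul_polar1_mem_reg1 ha hη, form1Incl_smul _ _⟩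
  d_J_mul := by
    rintro _ ⟨a, ha, rfl⟩ _ ⟨η, hη, rfl⟩
    exact ⟨_, D_wedge_polar1_mem_reg2 ha hη, form2Incl_wedge _ _⟩

end SmoothCurve

end LocalForms

/-! ### Germs of sections and frames of bundles -/

section Frames

variable {K : Type u} [Field K] {X : SmoothCurve K}

namespace SmoothCurve

variable (M : X.C.Modules)

theorem germ_smul {U : X.C.Opens} (x : X.C) (hx : x ∈ U) (a : Γ(X.C, U)) (s : Γ(M, U)) :
    germ M x hx (a • s) = X.C.presheaf.germ U x hx a • germ M x hx s :=
  let N : PresheafOfModules (X.C.presheaf ⋙ forget₂ CommRingCat RingCat) := M.val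
  N.germ_smul x U hx a s

theorem germ_res {U V : X.C.Opens} (h : V ≤ U) (x : X.C) (hx : x ∈ V) (s : Γ(M, U)) :
    germ M x hx (res M h s) = germ M x (h hx) s :=
  TopCat.Presheaf.germ_res_apply M.presheaf (homOfLE h) x hx s

theorem res_smul {U V : X.C.Opens} (h : V ≤ U) (a : Γ(X.C, U)) (s : Γ(M, U)) :
    res M h (a • s) = X.C.presheaf.map (homOfLE h).op a • res M h s :=
  Scheme.Modules.map_smul M (homOfLE h) a s

theorem res_res {U V W : X.C.Opens} (h : V ≤ U) (h' : W ≤ V) (s : Γ(M, U)) :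
    res M h' (res M h s) = res M (h'.trans h) s := by
  have := M.presheaf.map_comp (homOfLE h).op (homOfLE h').op
  exact (congrArg (fun f => f.hom s) this).symm

theorem exists_germ {x : X.C} (z : stalk M x) :
    ∃ (U : X.C.Opens) (hx : x ∈ U) (s : Γ(M, U)), germ M x hx s = z :=
  TopCat.Presheaf.exists_germ_eq M.presheaf z

theorem germ_eq {x : X.C} {U V : X.C.Opens} (hU : x ∈ U) (hV : x ∈ V) (s : Γ(M, U))
    (t : Γ(M, V)) (h : germ M x hU s = germ M x hV t) :
    ∃ (W : X.C.Opens) (_ : x ∈ W) (hWU : W ≤ U) (hWV : W ≤ V), res M hWU s = res M hWV t := by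
  obtain ⟨W, hW, i, j, h⟩ := TopCat.Presheaf.germ_eq M.presheaf x hU hV s t h
  exact ⟨W, hW, leOfHom i, leOfHom j, h⟩

/-- Finitely many germs of functions are induced by functions on a common open set. -/
theorem exists_germs {ι : Type*} [Finite ι] {U : X.C.Opens} {x : X.C} (hx : x ∈ U)
    (a : ι → X.C.presheaf.stalk x) :
    ∃ (V : X.C.Opens) (hV : x ∈ V) (_ : V ≤ U) (f : ι → Γ(X.C, V)),
      ∀ i, X.C.presheaf.germ V x hV (f i) = a i := by
  have := Fintype.ofFinite ι
  choose W hW f hf using fun i => X.C.presheaf.exists_germ_eq (a i)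
  let V : X.C.Opens := ⟨(U : Set X.C) ∩ ⋂ i, (W i : Set X.C),
    U.isOpen.inter (isOpen_iInter_of_finite fun i => (W i).isOpen)⟩
  have hVW (i) : V ≤ W i := fun y hy => Set.mem_iInter.mp hy.2 i
  refine ⟨V, ⟨hx, Set.mem_iInter.mpr hW⟩, fun y hy => hy.1,
    fun i => X.C.presheaf.map (homOfLE (hVW i)).op (f i), fun i => ?_⟩
  rw [← hf i]
  exact X.C.presheaf.germ_res_apply (homOfLE (hVW i)) x _ (f i)

variable {M} {r : ℕ} {U : X.C.Opens} {e : Fin r → Γ(M, U)}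

theorem IsFrame.restrict (he : IsFrame M e) {V : X.C.Opens} (h : V ≤ U) :
    IsFrame M fun i => res M h (e i) := fun W hW => by
  simpa only [res_res] using he W (hW.trans h)

theorem IsFrame.ext (he : IsFrame M e) {a b : Fin r → Γ(X.C, U)}
    (h : ∑ i, a i • e i = ∑ i, b i • e i) : a = b := by
  refine (he U le_rfl).1 ?_
  have (s : Γ(M, U)) : res M le_rfl s = s :=
    congrArg (fun f => f.hom s) (M.presheaf.map_id (op U))
  simpa only [this] using h

theorem germ_sum {ι : Type*} [Fintype ι] (x : X.C) (hx : x ∈ U) (a : ι → Γ(X.C, U))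
    (s : ι → Γ(M, U)) : germ M x hx (∑ i, a i • s i) =
      ∑ i, X.C.presheaf.germ U x hx (a i) • germ M x hx (s i) := by
  rw [map_sum]
  exact Finset.sum_congr rfl fun i _ => germ_smul M x hx _ _

/-- The germs of a frame are a basis of the stalk. -/
def IsFrame.basis (he : IsFrame M e) (x : X.C) (hx : x ∈ U) :
    Module.Basis (Fin r) (X.C.presheaf.stalk x) (stalk M x) :=
  Module.Basis.mk (v := fun i => germ M x hx (e i))
    (by
      rw [Fintype.linearIndependent_iff]
      intro a ha
      -- A linear relation between germs spreads to a neighbourhood, where the restricted frame is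
      -- still injective.
      obtain ⟨V, hV, hVU, f, hf⟩ := exists_germs hx a
      have h0 : germ M x hV (∑ i, f i • res M hVU (e i)) = germ M x hV 0 := by
        rw [germ_sum, map_zero, ← ha]
        refine Finset.sum_congr rfl fun i _ => ?_
        rw [hf, germ_res]
      obtain ⟨W, hW, hWV, _, h⟩ := germ_eq M hV hV _ _ h0
      have h1 : (fun i => X.C.presheaf.map (homOfLE hWV).op (f i)) = 0 := by
        refine (he.restrict (hWV.trans hVU)).ext ?_
        simp only [Pi.zero_apply, zero_smul, Finset.sum_const_zero]
        rw [map_zero, map_sum] at h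
        rw [← h]
        refine Finset.sum_congr rfl fun i _ => ?_
        rw [res_smul, res_res]
      intro i
      rw [← hf i, ← X.C.presheaf.germ_res_apply (homOfLE hWV) x hW (f i)]
      have h2 := congrFun h1 i
      dsimp only at h2
      rw [h2]
      exact map_zero _)
    (by
      intro z _
      obtain ⟨V, hV, s, rfl⟩ := exists_germ M z
      obtain ⟨a, ha⟩ := (he (V ⊓ U) inf_le_right).2 (res M inf_le_left s)
      have hx' : x ∈ V ⊓ U := ⟨hV, hx⟩
      dsimp only at ha
      rw [← germ_res M (inf_le_left : V ⊓ U ≤ V) x hx', ← ha, germ_sum]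
      refine sum_mem fun i _ => Submodule.smul_mem _ _ (Submodule.subset_span ⟨i, ?_⟩)
      exact (germ_res M inf_le_right x hx' (e i)).symm)

@[simp]
theorem IsFrame.basis_apply (he : IsFrame M e) (x : X.C) (hx : x ∈ U) (i : Fin r) :
    he.basis x hx i = germ M x hx (e i) := Module.Basis.mk_apply _ _ i

/-! ### The generic fibre -/

theorem genericPoint_mem (hU : Nonempty U) : genericPoint X.C ∈ U :=
  ((genericPoint_spec X.C).mem_open_set_iff U.isOpen).mpr (by simpa using hU)

theorem toGeneric_germ (x : X.C) (hx : x ∈ U) (s : Γ(M, U)) :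
    toGeneric M x (germ M x hx s) = generic M ⟨⟨x, hx⟩⟩ s :=
  TopCat.Presheaf.germ_stalkSpecializes_apply M.presheaf hx
    ((genericPoint_spec X.C).specializes trivial) s

theorem algebraMap_germ (x : X.C) (hx : x ∈ U) (a : Γ(X.C, U)) :
    algebraMap _ X.C.functionField (X.C.presheaf.germ U x hx a) = X.rat ⟨⟨x, hx⟩⟩ a :=
  TopCat.Presheaf.germ_stalkSpecializes_apply X.C.presheaf hx
    ((genericPoint_spec X.C).specializes trivial) a

theorem generic_smul (hU : Nonempty U) (a : Γ(X.C, U)) (s : Γ(M, U)) :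
    generic M hU (a • s) = X.rat hU a • generic M hU s :=
  germ_smul M (genericPoint X.C) (genericPoint_mem hU) a s

theorem generic_res (hU : Nonempty U) {V : X.C.Opens} (hV : Nonempty V) (h : V ≤ U)
    (s : Γ(M, U)) : generic M hV (res M h s) = generic M hU s :=
  germ_res M h _ (genericPoint_mem hV) s

/-- Specialization of stalks is given only as an additive map; its linearity is checked on sections
over a common neighbourhood. -/
theorem toGeneric_smul (x : X.C) (a : X.C.presheaf.stalk x) (z : stalk M x) :
    toGeneric M x (a • z) = algebraMap _ X.C.functionField a • toGeneric M x z := by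
  obtain ⟨U, hU, s, rfl⟩ := exists_germ M z
  obtain ⟨V, hV, hVU, f, hf⟩ := exists_germs (ι := Unit) hU fun _ => a
  rw [← hf (), ← germ_res M hVU x hV, ← germ_smul, toGeneric_germ, generic_smul, algebraMap_germ,
    toGeneric_germ]

theorem rat_mem_localRing (hU : Nonempty U) {x : X.C} (hx : x ∈ U) (a : Γ(X.C, U)) :
    X.rat hU a ∈ X.localRing x := ⟨_, algebraMap_germ x hx a⟩

/-- The values of a frame in the generic fibre are a basis. -/
def IsFrame.genericBasis (he : IsFrame M e) (hU : Nonempty U) :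
    Module.Basis (Fin r) X.C.functionField (genericFibre M) :=
  he.basis (genericPoint X.C) (genericPoint_mem hU)

@[simp]
theorem IsFrame.genericBasis_apply (he : IsFrame M e) (hU : Nonempty U) (i : Fin r) :
    he.genericBasis hU i = generic M hU (e i) := he.basis_apply _ _ i

end SmoothCurve

end Frames

/-! ### Coordinates -/

section Coordinates

variable {R : Type*} [CommRing R] {V W : Type*} [AddCommGroup V] [AddCommGroup W] [Module R V]
  [Module R W] {r : ℕ} {ι : Type*}

/-- The product of a matrix with a family of vectors. -/
def frameMul (A : Matrix (Fin r) (Fin r) R) (v : Fin r → V) : Fin r → V :=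
  fun a => ∑ b, A a b • v b

theorem frameMul_mul (A B : Matrix (Fin r) (Fin r) R) (v : Fin r → V) :
    frameMul (A * B) v = frameMul A (frameMul B v) := by
  ext a
  simp only [frameMul, Matrix.mul_apply, Finset.sum_smul, Finset.smul_sum, mul_smul]
  exact Finset.sum_comm

theorem frameMul_one (v : Fin r → V) : frameMul (1 : Matrix (Fin r) (Fin r) R) v = v := by
  ext a
  simp [frameMul, Matrix.one_apply]

theorem frameMul_smul (c : R) (A : Matrix (Fin r) (Fin r) R) (v : Fin r → V) :
    frameMul (c • A) v = c • frameMul A v := by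
  ext a
  simp [frameMul, Finset.smul_sum, mul_smul]

theorem map_frameMul (f : V →ₗ[R] W) (A : Matrix (Fin r) (Fin r) R) (v : Fin r → V) (a : Fin r) :
    f (frameMul A v a) = frameMul A (f ∘ v) a := by
  simp [frameMul]

/-- The coordinate of a tensor with respect to a basis of the first factor. -/
def tensorCoord (b : Module.Basis ι R V) (i : ι) : V ⊗[R] W →ₗ[R] W :=
  (TensorProduct.lid R W).toLinearMap ∘ₗ (b.coord i).rTensor W

@[simp]
theorem tensorCoord_tmul (b : Module.Basis ι R V) (i : ι) (v : V) (w : W) :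
    tensorCoord b i (v ⊗ₜ[R] w) = b.repr v i • w := by
  simp [tensorCoord]

theorem sum_tmul_tensorCoord [Fintype ι] (b : Module.Basis ι R V) (t : V ⊗[R] W) :
    ∑ i, b i ⊗ₜ[R] tensorCoord b i t = t := by
  induction t with
  | zero => simp
  | add x y hx hy => simp [TensorProduct.tmul_add, Finset.sum_add_distrib, hx, hy]
  | tmul v w =>
    simp only [tensorCoord_tmul, ← TensorProduct.smul_tmul, ← TensorProduct.sum_tmul, b.sum_repr]

/-- Converts an equality of vectors along the divisor into congruences between matrix entries. -/
theorem repr_mem_of_mem_smul_top (b : Module.Basis ι R V) {I : Ideal R} {z : V}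
    (hz : z ∈ (I • ⊤ : Submodule R V)) (i : ι) : b.repr z i ∈ I := by
  refine Submodule.smul_induction_on hz (fun a ha v _ => ?_) fun v w hv hw => ?_
  · rw [map_smul, Finsupp.smul_apply, smul_eq_mul]
    exact Ideal.mul_mem_right _ _ ha
  · rw [map_add, Finsupp.add_apply]
    exact add_mem hv hw

end Coordinates

/-! ### Matrices of the connection and of the trivialization -/

section LocalFrames

variable {k : Type v} {K : Type u} [Field k] [Field K] [Algebra k K] {X : SmoothCurve K}
  {𝓓 : RationalDivisor X} {E L : X.C.Modules} {r : ℕ}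

namespace SmoothCurve

/-- Guarantees that taking coordinates in a frame preserves the conditions on forms at `x`: elements
of the stalk have coordinates in the local ring. -/
theorem IsFrame.genericBasis_repr_toGeneric {M : X.C.Modules} {U : X.C.Opens}
    {e : Fin r → Γ(M, U)} (he : IsFrame M e) (x : X.C) (hx : x ∈ U) (z : stalk M x) (i : Fin r) :
    (he.genericBasis ⟨⟨x, hx⟩⟩).repr (toGeneric M x z) i =
      algebraMap _ X.C.functionField ((he.basis x hx).repr z i) := by
  have h : toGeneric M x z = ∑ i, algebraMap _ X.C.functionField ((he.basis x hx).repr z i) •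
      he.genericBasis ⟨⟨x, hx⟩⟩ i := by
    conv_lhs => rw [← (he.basis x hx).sum_repr z]
    rw [map_sum]
    refine Finset.sum_congr rfl fun i _ => ?_
    rw [toGeneric_smul, he.basis_apply, toGeneric_germ, he.genericBasis_apply]
  rw [h, Module.Basis.repr_sum_self]

/-- The entries of the matrix of a connection have the prescribed poles. -/
theorem isPolar1_tensorCoord (nabla : PolarConnection k 𝓓 E) {U : X.C.Opens} (hU : Nonempty U)
    {e : Fin r → Γ(E, U)} (he : IsFrame E e) (s : Γ(E, U)) (i : Fin r) (x : X.C) (hx : x ∈ U) :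
    IsPolar1 k 𝓓 x (tensorCoord (he.genericBasis hU) i (nabla.app hU s)) := by
  have h : polarStalk 𝓓 E x ≤
      (polar1 k 𝓓 x).comap (tensorCoord (he.genericBasis hU) i).toAddMonoidHom := by
    refine (AddSubgroup.closure_le _).mpr ?_
    rintro _ ⟨z, η, hη, rfl⟩
    change tensorCoord (he.genericBasis hU) i (toGeneric E x z ⊗ₜ η) ∈ polar1 k 𝓓 x
    rw [tensorCoord_tmul, he.genericBasis_repr_toGeneric x hx]
    exact smul_mem_polar1 (algebraMap_mem_localRing _) hη
  exact h (nabla.app_mem hU s x hx)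

variable (E L) in
/-- The sections `e` and the generator `l` trivialize a regular form with values in `E ⊗ L`. -/
theorem tensorCoord_mem_reg1 {U : X.C.Opens} (hU : Nonempty U)
    {e : Fin r → Γ(E, U)} (he : IsFrame E e) {l : Γ(L, U)} (hl : IsFrame L fun _ : Fin 1 => l)
    (x : X.C) (hx : x ∈ U) {t} (ht : t ∈ regularStalk (k := k) E L x) (i : Fin r) :
    tensorCoord ((he.genericBasis hU).tensorProduct (hl.genericBasis hU)) (i, 0) t ∈
      X.reg1 k x := by
  have h : regularStalk (k := k) E L x ≤ (X.reg1 k x).toAddSubgroup.comap (tensorCoord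
      ((he.genericBasis hU).tensorProduct (hl.genericBasis hU)) (i, 0)).toAddMonoidHom := by
    refine (AddSubgroup.closure_le _).mpr ?_
    rintro _ ⟨z, w, η, hη, rfl⟩
    change tensorCoord ((he.genericBasis hU).tensorProduct (hl.genericBasis hU)) (i, 0)
      ((toGeneric E x z ⊗ₜ toGeneric L x w) ⊗ₜ η) ∈ X.reg1 k x
    rw [tensorCoord_tmul, Module.Basis.tensorProduct_repr_tmul_apply,
      he.genericBasis_repr_toGeneric x hx, hl.genericBasis_repr_toGeneric x hx, smul_eq_mul,
      ← map_mul]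
    exact smul_mem_of_mem _ (algebraMap_mem_localRing _) hη
  exact h ht

end SmoothCurve

open SmoothCurve

namespace LocalData

variable {nabla : PolarConnection k 𝓓 E} {g : TrivializationAlong 𝓓 E L}
  (d : LocalData r nabla g)

/-- The transition matrix of `E`, as a matrix of rational functions. -/
def ratC (i j : d.cov.I) : Matrix (Fin r) (Fin r) X.C.functionField :=
  (d.c i j : Matrix (Fin r) (Fin r) Γ(X.C, d.cov.U₂ i j)).map (X.rat (d.nonempty₂ i j))

/-- The inverse transition matrix of `E`, as a matrix of rational functions. -/
def ratC' (i j : d.cov.I) : Matrix (Fin r) (Fin r) X.C.functionField :=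
  ((d.c i j)⁻¹ : GL (Fin r) Γ(X.C, d.cov.U₂ i j)).1.map (X.rat (d.nonempty₂ i j))

/-- The lifted matrix of the trivialization, as a matrix of rational functions. -/
def ratM (i : d.cov.I) : Matrix (Fin r) (Fin r) X.C.functionField :=
  (d.μ i : Matrix (Fin r) (Fin r) Γ(X.C, d.cov.U i)).map (X.rat (d.cov.nonempty i))

/-- The inverse of the lifted matrix of the trivialization. -/
def ratM' (i : d.cov.I) : Matrix (Fin r) (Fin r) X.C.functionField :=
  ((d.μ i)⁻¹ : GL (Fin r) Γ(X.C, d.cov.U i)).1.map (X.rat (d.cov.nonempty i))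

theorem map_mul_map_inv {A B : Type*} [CommRing A] [CommRing B] (f : A →+* B)
    (c : GL (Fin r) A) : c.1.map f * (c⁻¹).1.map f = 1 := by
  rw [← Matrix.map_mul, Units.mul_inv]
  exact Matrix.map_one _ (map_zero _) (map_one _)

theorem ratC_mul (i j : d.cov.I) : d.ratC i j * d.ratC' i j = 1 := map_mul_map_inv _ _

theorem ratM_mul (i : d.cov.I) : d.ratM i * d.ratM' i = 1 := map_mul_map_inv _ _

theorem generic_e (i j : d.cov.I) (a : Fin r) :
    generic E (d.cov.nonempty i) (d.e i a) =
      ∑ b, d.ratC i j a b • generic E (d.cov.nonempty j) (d.e j b) := by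
  have h := congrArg (generic E (d.nonempty₂ i j)) (d.c_spec i j a)
  rw [generic_res (d.cov.nonempty i), map_sum] at h
  rw [h]
  refine Finset.sum_congr rfl fun b _ => ?_
  rw [generic_smul, generic_res (d.cov.nonempty j)]
  rfl

/-- The change of the connection matrix under a change of frame. -/
theorem gauge (i j : d.cov.I) (a t : Fin r) :
    ∑ b, d.ratC i j b t • d.ω i a b =
      KaehlerDifferential.D k _ (d.ratC i j a t) + ∑ b, d.ratC i j a b • d.ω j b t := by
  -- Apply the connection to `e_i = c_ij e_j` on the overlap and compare coordinates in the frame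
  -- `e_j`.
  have h := congrArg (nabla.app (d.nonempty₂ i j)) (d.c_spec i j a)
  rw [nabla.app_res (d.cov.nonempty i), d.ω_spec, map_sum] at h
  have h' := congrArg (tensorCoord ((d.isFrame_e j).genericBasis (d.cov.nonempty j)) t) h
  have hrepr (b : Fin r) : ((d.isFrame_e j).genericBasis (d.cov.nonempty j)).repr
      (generic E (d.cov.nonempty j) (d.e j b)) = Finsupp.single b 1 := by
    rw [← IsFrame.genericBasis_apply (d.isFrame_e j) (d.cov.nonempty j) b,
      Module.Basis.repr_self]
  simp only [map_sum, tensorCoord_tmul, d.generic_e i j, map_smul, hrepr,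
    Finsupp.smul_single, smul_eq_mul, mul_one, Finsupp.coe_finsetSum, Finset.sum_apply,
    Finsupp.single_apply, Finset.sum_ite_eq', Finset.mem_univ, if_true] at h'
  rw [h']
  have hterm (b : Fin r) : nabla.app (d.nonempty₂ i j)
      (d.c i j a b • res E inf_le_right (d.e j b)) = d.ratC i j a b •
        (∑ t, generic E (d.cov.nonempty j) (d.e j t) ⊗ₜ d.ω j b t) +
        generic E (d.cov.nonempty j) (d.e j b) ⊗ₜ
          KaehlerDifferential.D k X.C.functionField (d.ratC i j a b) := by
    rw [nabla.leibniz, nabla.app_res (d.cov.nonempty j), d.ω_spec,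
      generic_res (d.cov.nonempty j)]
    rfl
  simp only [hterm, map_add, map_smul, map_sum, tensorCoord_tmul, hrepr, Finsupp.single_apply,
    ite_smul, one_smul, zero_smul, Finset.sum_ite_eq', Finset.mem_univ, if_true,
    Finset.sum_add_distrib]
  rw [add_comm]

/-- The germs of the frame of `E`. -/
def frameGerm (i : d.cov.I) (x : X.C) (hx : x ∈ d.cov.U i) : Fin r → stalk E x :=
  fun a => germ E x hx (d.e i a)

/-- The germs of a matrix of functions. -/
abbrev germMatrix {U : X.C.Opens} (x : X.C) (hx : x ∈ U)
    (A : Matrix (Fin r) (Fin r) Γ(X.C, U)) : Matrix (Fin r) (Fin r) (X.C.presheaf.stalk x) :=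
  A.map (X.C.presheaf.germ U x hx).hom

theorem germMatrix_map {U : X.C.Opens} (x : X.C) (hx : x ∈ U)
    (A : Matrix (Fin r) (Fin r) Γ(X.C, U)) :
    (germMatrix x hx A).map (algebraMap _ X.C.functionField) = A.map (X.rat ⟨⟨x, hx⟩⟩) := by
  ext i j
  exact algebraMap_germ x hx (A i j)

/-- The isomorphism `g` at `x`, composed with the projection. -/
def trivAt (g : TrivializationAlong 𝓓 E L) (x : X.C) :
    stalk E x →ₗ[X.C.presheaf.stalk x]
      Along 𝓓 x (stalk E x ⊗[X.C.presheaf.stalk x] stalk L x) :=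
  (g x).toLinearMap ∘ₗ Submodule.mkQ _

theorem trivAt_frameMul (i : d.cov.I) (x : X.C) (hx : x ∈ d.cov.U i) (a : Fin r) :
    trivAt g x (frameMul (germMatrix x hx (d.μ i).1) (d.frameGerm i x hx) a) =
      Submodule.Quotient.mk (d.frameGerm i x hx a ⊗ₜ germ L x hx (d.ell i)) := by
  rw [frameGerm, ← d.μ_spec i a x hx, germ_sum]
  rfl

/-- Inverts the normalization `g(μ e) = e ⊗ ℓ` to `g(e) = μ⁻¹ e ⊗ ℓ`. The entries of `μ⁻¹` are
attached to `ℓ`, the shape in which `Commutes` can be applied. -/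
theorem trivAt_frameGerm (i : d.cov.I) (x : X.C) (hx : x ∈ d.cov.U i) (a : Fin r) :
    trivAt g x (d.frameGerm i x hx a) = Submodule.Quotient.mk
      (∑ b, d.frameGerm i x hx b ⊗ₜ germ L x hx ((d.μ i)⁻¹.1 a b • d.ell i)) := by
  have h : d.frameGerm i x hx = frameMul (germMatrix x hx (d.μ i)⁻¹.1)
      (frameMul (germMatrix x hx (d.μ i).1) (d.frameGerm i x hx)) := by
    rw [← frameMul_mul]
    have := map_mul_map_inv (X.C.presheaf.germ _ x hx).hom (d.μ i)
    rw [mul_eq_one_comm.mp this, frameMul_one]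
  conv_lhs => rw [h]
  rw [map_frameMul, frameMul]
  simp only [Function.comp_apply, d.trivAt_frameMul i x hx]
  simp only [← Submodule.mkQ_apply, ← map_smul, ← map_sum]
  congr 1
  refine Finset.sum_congr rfl fun b _ => ?_
  rw [germ_smul, TensorProduct.tmul_smul]
  rfl

/-- The matrix of the trivialization commutes with the polar part of the connection. -/
theorem commutator_mem_reg1 (hg : Commutes nabla g) (i : d.cov.I) (x : X.C)
    (hx : x ∈ d.cov.U i) (a t : Fin r) :
    ∑ b, d.ratM' i a b • d.ω i b t - ∑ b, d.ratM' i b t • d.ω i a b ∈ X.reg1 k x := by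
  -- The frame itself serves as both auxiliary families of sections of `E`; the `e_t ⊗ ℓ` coordinate
  -- is then an entry of `μ⁻¹ ω - ω μ⁻¹`.
  have h := hg x (d.cov.U i) hx r r (d.e i a) (d.e i) (d.ω i a) (d.e i)
    (fun b => (d.μ i)⁻¹.1 a b • d.ell i) (fun b t => (d.μ i)⁻¹.1 b t • d.ell i)
    (fun j => d.ω_polar i a j x hx) (d.ω_spec i a) (d.trivAt_frameGerm i x hx a)
    (fun b => d.trivAt_frameGerm i x hx b)
  have h' := tensorCoord_mem_reg1 E L (d.cov.nonempty i) (d.isFrame_e i) (d.isFrame_ell i) x hx h t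
  have hrepr (b : Fin r) : ((d.isFrame_e i).genericBasis (d.cov.nonempty i)).repr
      (generic E (d.cov.nonempty i) (d.e i b)) = Finsupp.single b 1 := by
    rw [← IsFrame.genericBasis_apply (d.isFrame_e i) (d.cov.nonempty i) b,
      Module.Basis.repr_self]
  have hrepr' : ((d.isFrame_ell i).genericBasis (d.cov.nonempty i)).repr
      (generic L (d.cov.nonempty i) (d.ell i)) = Finsupp.single 0 1 := by
    rw [← IsFrame.genericBasis_apply (d.isFrame_ell i) (d.cov.nonempty i) 0,
      Module.Basis.repr_self]
  simp only [d.ω_spec, map_sum, map_sub, LinearMap.rTensor_tmul,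
    LinearMap.smul_apply, LinearMap.flip_apply,
    TensorProduct.mk_apply, tensorCoord_tmul, Module.Basis.tensorProduct_repr_tmul_apply, hrepr,
    generic_smul, map_smul, hrepr', Finsupp.smul_apply, Finsupp.single_apply, if_true,
    smul_eq_mul, mul_one, mul_ite, mul_zero, ite_smul, zero_smul,
    Finset.sum_ite_eq', Finset.mem_univ] at h'
  exact h'

end LocalData

end LocalFrames

/-! ### Comparison of trace forms on overlaps -/

section Cocycle

variable {k : Type v} {K : Type u} [Field k] [Field K] [Algebra k K] {X : SmoothCurve K}
  {𝓓 : RationalDivisor X} {E L : X.C.Modules} {r : ℕ}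

open SmoothCurve

namespace LocalData

variable {nabla : PolarConnection k 𝓓 E} {g : TrivializationAlong 𝓓 E L}
  (d : LocalData r nabla g)

/-- The transition function of `L`, as a rational function. -/
def ratLam (i j : d.cov.I) : X.C.functionField := X.rat (d.nonempty₂ i j) (d.lam i j).1

/-- The inverse of the transition function of `L`, as a rational function. -/
def ratLam' (i j : d.cov.I) : X.C.functionField := X.rat (d.nonempty₂ i j) (d.lam i j)⁻¹.1

theorem ratLam_mul (i j : d.cov.I) : d.ratLam i j * d.ratLam' i j = 1 := by
  rw [ratLam, ratLam', ← map_mul, Units.mul_inv, map_one]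

theorem ratLam'_eq (i j : d.cov.I) : d.ratLam' i j = (d.ratLam i j)⁻¹ :=
  (inv_eq_of_mul_eq_one_right (d.ratLam_mul i j)).symm

theorem frameGerm_eq (i j : d.cov.I) (x : X.C) (hx : x ∈ d.cov.U₂ i j) :
    d.frameGerm i x hx.1 = frameMul (germMatrix x hx (d.c i j).1) (d.frameGerm j x hx.2) := by
  ext a
  have h := congrArg (germ E x hx) (d.c_spec i j a)
  rw [germ_sum, SmoothCurve.germ_res] at h
  simp only [SmoothCurve.germ_res] at h
  exact h

theorem germ_ell_eq (i j : d.cov.I) (x : X.C) (hx : x ∈ d.cov.U₂ i j) :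
    germ L x hx.1 (d.ell i) =
      X.C.presheaf.germ _ x hx (d.lam i j).1 • germ L x hx.2 (d.ell j) := by
  have h := congrArg (germ L x hx) (d.lam_spec i j)
  rwa [germ_smul, SmoothCurve.germ_res, SmoothCurve.germ_res] at h

/-- The relation `μᵢ = λᵢⱼ cᵢⱼ μⱼ cᵢⱼ⁻¹` along the divisor. -/
theorem ratM_sub_mem (i j : d.cov.I) (x : X.C) (hx : x ∈ d.cov.U₂ i j) :
    HasEntriesIn (vanishing x 𝓓)
      (d.ratM i - d.ratLam i j • (d.ratC i j * d.ratM j * d.ratC' i j)) := by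
  set v := d.frameGerm i x hx.1
  set w := d.frameGerm j x hx.2
  set c := germMatrix x hx (d.c i j).1
  set c' := germMatrix x hx (d.c i j)⁻¹.1
  set m := germMatrix x hx.1 (d.μ i).1 with hm
  set n := germMatrix x hx.2 (d.μ j).1 with hn
  set l := X.C.presheaf.germ _ x hx (d.lam i j).1 with hl
  have hcc : c' * c = 1 :=
    mul_eq_one_comm.mp (map_mul_map_inv (X.C.presheaf.germ _ x hx).hom (d.c i j))
  have hvw : v = frameMul c w := d.frameGerm_eq i j x hx
  have hwv : w = frameMul c' v := by rw [hvw, ← frameMul_mul, hcc, frameMul_one]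
  -- Both matrices send the frame `e_i` to vectors whose image under `g` is `e_i ⊗ ℓ_i`. Injectivity
  -- of `g` then makes them congruent along the divisor.
  have key (a : Fin r) : trivAt g x (frameMul m v a) =
      trivAt g x (frameMul (l • (c * n * c')) v a) := by
    rw [d.trivAt_frameMul i x hx.1, frameMul_smul, mul_assoc, frameMul_mul, frameMul_mul, ← hwv,
      Pi.smul_apply, map_smul, map_frameMul]
    have : ⇑(trivAt g x) ∘ frameMul n w = fun b =>
        Submodule.Quotient.mk (w b ⊗ₜ germ L x hx.2 (d.ell j)) := by
      ext b
      exact d.trivAt_frameMul j x hx.2 b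
    rw [this, d.germ_ell_eq i j x hx, frameMul]
    simp only [← Submodule.mkQ_apply, ← map_smul, ← map_sum]
    congr 1
    rw [TensorProduct.tmul_smul]
    congr 1
    change v a ⊗ₜ _ = _
    rw [hvw, frameMul, TensorProduct.sum_tmul]
    rfl
  intro a b
  have h1 := (g x).injective (key a)
  rw [Submodule.mkQ_apply, Submodule.mkQ_apply, Submodule.Quotient.eq] at h1
  have h2 := repr_mem_of_mem_smul_top ((d.isFrame_e i).basis x hx.1) h1 b
  have hrepr (A : Matrix (Fin r) (Fin r) (X.C.presheaf.stalk x)) :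
      ((d.isFrame_e i).basis x hx.1).repr (frameMul A v a) b = A a b := by
    have : frameMul A v a = ∑ t, A a t • (d.isFrame_e i).basis x hx.1 t := by
      simp only [IsFrame.basis_apply]
      rfl
    rw [this, Module.Basis.repr_sum_self]
  rw [map_sub, Finsupp.sub_apply, hrepr, hrepr] at h2
  refine ⟨_, h2, ?_⟩
  change algebraMap _ X.C.functionField _ = _
  rw [map_sub]
  have e1 : m.map (algebraMap _ X.C.functionField) = d.ratM i := germMatrix_map x hx.1 _
  have e2 : (l • (c * n * c')).map (algebraMap _ X.C.functionField) =
      d.ratLam i j • (d.ratC i j * d.ratM j * d.ratC' i j) := by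
    have e3 : (c * n * c').map (algebraMap _ X.C.functionField) =
        d.ratC i j * d.ratM j * d.ratC' i j := by
      rw [Matrix.map_mul, Matrix.map_mul, germMatrix_map x hx, germMatrix_map x hx.2,
        germMatrix_map x hx]
      rfl
    rw [← e3]
    ext s t
    have e4 : algebraMap _ X.C.functionField l = d.ratLam i j := algebraMap_germ x hx _
    simp only [Matrix.map_apply, Matrix.smul_apply, smul_eq_mul, map_mul, e4]
  exact congrArg₂ (· - ·) (congrFun (congrFun e1 a) b) (congrFun (congrFun e2 a) b)

variable (k X) in
/-- A matrix of one-forms as a matrix over the algebra of forms. -/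
abbrev formMatrix (ω : Matrix (Fin r) (Fin r) (X.Form1 k)) : Matrix (Fin r) (Fin r) (X.Forms k) :=
  ω.map (form1Incl k X)

theorem scalarMatrix_mul_formMatrix_apply (A : Matrix (Fin r) (Fin r) X.C.functionField)
    (ω : Matrix (Fin r) (Fin r) (X.Form1 k)) (a b : Fin r) :
    (scalarMatrix (X.Forms k) A * formMatrix k X ω) a b =
      form1Incl k X (∑ t, A a t • ω t b) := by
  rw [Matrix.mul_apply, map_sum]
  refine Finset.sum_congr rfl fun t _ => ?_
  rw [form1Incl_smul, Algebra.smul_def]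
  rfl

theorem formMatrix_mul_scalarMatrix_apply (A : Matrix (Fin r) (Fin r) X.C.functionField)
    (ω : Matrix (Fin r) (Fin r) (X.Form1 k)) (a b : Fin r) :
    (formMatrix k X ω * scalarMatrix (X.Forms k) A) a b =
      form1Incl k X (∑ t, A t b • ω a t) := by
  rw [Matrix.mul_apply, map_sum]
  refine Finset.sum_congr rfl fun t _ => ?_
  rw [form1Incl_smul, Algebra.smul_def, Algebra.commutes]
  rfl

theorem formMatrix_gauge (i j : d.cov.I) :
    formMatrix k X (d.ω i) * scalarMatrix (X.Forms k) (d.ratC i j) =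
      (d.ratC i j).map (formD k X) +
        scalarMatrix (X.Forms k) (d.ratC i j) * formMatrix k X (d.ω j) := by
  ext a b
  rw [Matrix.add_apply, scalarMatrix_mul_formMatrix_apply, formMatrix_mul_scalarMatrix_apply,
    d.gauge i j a b, map_add]
  rfl

/-- In the exterior algebra the triple sum becomes the trace of a product of three matrices. -/
theorem form2Incl_traceForm (i : d.cov.I) : form2Incl k X (d.traceForm i) =
    ((d.ratM i).map (formD k X) * scalarMatrix (X.Forms k) (d.ratM' i) *
      formMatrix k X (d.ω i)).trace := by
  rw [traceForm, map_sum, Matrix.trace]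
  refine Finset.sum_congr rfl fun a _ => ?_
  rw [Matrix.diag_apply, mul_assoc, Matrix.mul_apply, map_sum]
  refine Finset.sum_congr rfl fun b _ => ?_
  rw [scalarMatrix_mul_formMatrix_apply, map_sum, map_sum, Finset.mul_sum]
  refine Finset.sum_congr rfl fun t _ => ?_
  rw [map_smul, LinearMap.smul_apply, ← map_smul, form2Incl_wedge]
  rfl

theorem trace_formMatrix (ω : Matrix (Fin r) (Fin r) (X.Form1 k)) :
    (formMatrix k X ω).trace = form1Incl k X ω.trace := by
  rw [Matrix.trace, Matrix.trace, map_sum]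
  rfl

theorem ratC_entries (i j : d.cov.I) (x : X.C) (hx : x ∈ d.cov.U₂ i j) :
    HasEntriesIn (X.localRing x).toAddSubgroup (d.ratC i j) :=
  fun _ _ => rat_mem_localRing (d.nonempty₂ i j) hx _

theorem ratC'_entries (i j : d.cov.I) (x : X.C) (hx : x ∈ d.cov.U₂ i j) :
    HasEntriesIn (X.localRing x).toAddSubgroup (d.ratC' i j) :=
  fun _ _ => rat_mem_localRing (d.nonempty₂ i j) hx _

theorem ratM_entries (i : d.cov.I) (x : X.C) (hx : x ∈ d.cov.U i) :
    HasEntriesIn (X.localRing x).toAddSubgroup (d.ratM i) :=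
  fun _ _ => rat_mem_localRing (d.cov.nonempty i) hx _

theorem ratM'_entries (i : d.cov.I) (x : X.C) (hx : x ∈ d.cov.U i) :
    HasEntriesIn (X.localRing x).toAddSubgroup (d.ratM' i) :=
  fun _ _ => rat_mem_localRing (d.cov.nonempty i) hx _

theorem dlogLam_eq (i j : d.cov.I) :
    form1Incl k X (d.dlogLam i j) = d.ratLam' i j • formD k X (d.ratLam i j) := by
  rw [ratLam'_eq]
  exact form1Incl_smul _ _

/-- The trace forms satisfy `δc = b` modulo regular forms. -/
theorem traceForm_sub_mem (hg : Commutes nabla g) (i j : d.cov.I) (x : X.C)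
    (hx : x ∈ d.cov.U₂ i j) :
    d.traceForm i - d.traceForm j - wedge k _ (d.dlogLam i j) (d.ω j).trace ∈ X.reg2 k x := by
  -- Here `n` is the lift `μ_i`, `m` is `μ_j`, and the commutator hypothesis is needed only for the
  -- index `j`.
  have h := (formFiltration (k := k) 𝓓 x).trace_change_frame (d.ratC_entries i j x hx)
    (d.ratC'_entries i j x hx) (d.ratM_entries j x hx.2) (d.ratM'_entries j x hx.2)
    (d.ratM'_entries i x hx.1) (rat_mem_localRing (d.nonempty₂ i j) hx _)
    (rat_mem_localRing (d.nonempty₂ i j) hx _) (d.ratC_mul i j) (d.ratM_mul j)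
    (mul_eq_one_comm.mp (d.ratM_mul i)) (d.ratLam_mul i j)
    (ω := formMatrix k X (d.ω i)) (ω' := formMatrix k X (d.ω j))
    (fun a b => ⟨_, d.ω_polar i a b x hx.1, rfl⟩) (d.ratM_sub_mem i j x hx)
    (d.formMatrix_gauge i j) (fun a b => by
      rw [Matrix.sub_apply, scalarMatrix_mul_formMatrix_apply, formMatrix_mul_scalarMatrix_apply,
        ← map_sub]
      exact ⟨_, d.commutator_mem_reg1 hg j x hx.2 a b, rfl⟩)
  rw [← form2Incl_traceForm, ← form2Incl_traceForm] at h
  have h2 : d.ratLam' i j • formD k X (d.ratLam i j) * (formMatrix k X (d.ω j)).trace =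
      form2Incl k X (wedge k _ (d.dlogLam i j) (d.ω j).trace) := by
    rw [form2Incl_wedge, d.dlogLam_eq, trace_formMatrix]
  erw [h2] at h
  rw [← map_sub, ← map_sub] at h
  obtain ⟨η, hη, h3⟩ := h
  rw [← form2Incl_injective h3]
  exact hη

/-- The trace of the connection matrix changes by the logarithmic differential of `det c`. -/
theorem trace_sub_trace (i j : d.cov.I) : (d.ω i).trace - (d.ω j).trace =
    dlogForm k _ (X.rat (d.nonempty₂ i j) (d.c i j).1.det) := by
  have hdet : X.rat (d.nonempty₂ i j) (d.c i j).1.det = (d.ratC i j).det :=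
    RingHom.map_det _ _
  have hu : IsUnit (d.ratC i j).det := Matrix.isUnit_det_of_right_inverse (d.ratC_mul i j)
  have h := trace_map_mul_inv (formD k X) (formFiltration (k := k) 𝓓 (genericPoint X.C)).leibniz
    (d.ratC i j) hu.ne_zero
  rw [Matrix.inv_eq_right_inv (d.ratC_mul i j)] at h
  have hinj : Function.Injective (form1Incl k X) := ExteriorAlgebra.ι_leftInverse.injective
  refine hinj ?_
  rw [map_sub, hdet]
  refine (?_ : _ = _).trans (form1Incl_smul (d.ratC i j).det⁻¹ _).symm
  refine Eq.trans ?_ h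
  rw [← trace_formMatrix, ← trace_formMatrix, sub_eq_iff_eq_add]
  -- The gauge formula solved for `ω_i`; taking traces removes the conjugation of `ω_j` and leaves
  -- `Tr(dc c⁻¹)`.
  have e : formMatrix k X (d.ω i) = (d.ratC i j).map (formD k X) *
      scalarMatrix (X.Forms k) (d.ratC' i j) + scalarMatrix (X.Forms k) (d.ratC i j) *
        formMatrix k X (d.ω j) * scalarMatrix (X.Forms k) (d.ratC' i j) := by
    rw [← add_mul, ← formMatrix_gauge, mul_assoc, ← scalarMatrix_mul, d.ratC_mul,
      scalarMatrix_one, mul_one]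
  rw [e, Matrix.trace_add, trace_scalarMatrix_conj (mul_eq_one_comm.mp (d.ratC_mul i j))]

end LocalData

end Cocycle

/-! ### Bilinearity of Milnor symbols -/

section MilnorSymbols

variable {R : Type u} [CommRing R]

theorem milnorSymbol_mul_left (a b c : Rˣ) :
    milnorSymbol (a * b) c = milnorSymbol a c + milnorSymbol b c := by
  simp only [milnorSymbol, ofMul_mul, TensorProduct.add_tmul]
  rfl

theorem milnorSymbol_mul_right (a b c : Rˣ) :
    milnorSymbol a (b * c) = milnorSymbol a b + milnorSymbol a c := by
  simp only [milnorSymbol, ofMul_mul, TensorProduct.tmul_add]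
  rfl

theorem dlogK2_milnorSymbol (k : Type v) (F : Type u) [Field k] [Field F] [Algebra k F]
    [Algebra R F] (a b : Rˣ) : dlogK2 k F (milnorSymbol a b) =
      wedge k F (dlogForm k F (algebraMap R F a)) (dlogForm k F (algebraMap R F b)) := rfl

end MilnorSymbols

/-! ### The Čech cocycle conditions -/

section CechCocycle

variable {k : Type v} {K : Type u} [Field k] [Field K] [Algebra k K] {X : SmoothCurve K}
  {𝓓 : RationalDivisor X} {E L : X.C.Modules} {r : ℕ}

open SmoothCurve

namespace LocalData

variable {nabla : PolarConnection k 𝓓 E} {g : TrivializationAlong 𝓓 E L}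
  (d : LocalData r nabla g)

/-- The germ of a unit. -/
abbrev germUnit {U : X.C.Opens} (x : X.C) (hx : x ∈ U) : Γ(X.C, U)ˣ →* (X.C.presheaf.stalk x)ˣ :=
  Units.map (X.C.presheaf.germ U x hx).hom.toMonoidHom

/-- The generator `ℓ_l` is a basis of the stalk, so the two expressions of `ℓ_i` through it have the
same coefficient. -/
theorem germUnit_lam (i j l : d.cov.I) (x : X.C) (hx : x ∈ d.cov.U₃ i j l) :
    germUnit x (U := d.cov.U₂ i l) ⟨hx.1.1, hx.2⟩ (d.lam i l) =
      germUnit x hx.1 (d.lam i j) * germUnit x (U := d.cov.U₂ j l) ⟨hx.1.2, hx.2⟩ (d.lam j l) := by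
  have h := d.germ_ell_eq i l x ⟨hx.1.1, hx.2⟩
  rw [d.germ_ell_eq i j x hx.1, d.germ_ell_eq j l x ⟨hx.1.2, hx.2⟩, smul_smul] at h
  have hb := congrArg (fun z => ((d.isFrame_ell l).basis x hx.2).repr z 0) h
  have e : germ L x hx.2 (d.ell l) = (d.isFrame_ell l).basis x hx.2 0 := by
    rw [IsFrame.basis_apply]
  simp only [e, map_smul, Module.Basis.repr_self, Finsupp.smul_apply, Finsupp.single_eq_same,
    smul_eq_mul, mul_one] at hb
  ext
  exact hb.symm

theorem germMatrix_c (i j l : d.cov.I) (x : X.C) (hx : x ∈ d.cov.U₃ i j l) :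
    germMatrix x (U := d.cov.U₂ i l) ⟨hx.1.1, hx.2⟩ (d.c i l).1 =
      germMatrix x (U := d.cov.U₂ i j) hx.1 (d.c i j).1 *
        germMatrix x (U := d.cov.U₂ j l) ⟨hx.1.2, hx.2⟩ (d.c j l).1 := by
  have h := d.frameGerm_eq i l x ⟨hx.1.1, hx.2⟩
  rw [d.frameGerm_eq i j x hx.1, d.frameGerm_eq j l x ⟨hx.1.2, hx.2⟩, ← frameMul_mul] at h
  ext a b
  have hrepr (A : Matrix (Fin r) (Fin r) (X.C.presheaf.stalk x)) :
      ((d.isFrame_e l).basis x hx.2).repr (frameMul A (d.frameGerm l x hx.2) a) b = A a b := by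
    have : frameMul A (d.frameGerm l x hx.2) a =
        ∑ t, A a t • (d.isFrame_e l).basis x hx.2 t := by
      simp only [IsFrame.basis_apply]
      rfl
    rw [this, Module.Basis.repr_sum_self]
  have hb := congrArg (fun z => ((d.isFrame_e l).basis x hx.2).repr (z a) b) h
  simp only [hrepr] at hb
  exact hb.symm

theorem coe_germUnit_det {U : X.C.Opens} (x : X.C) (hx : x ∈ U) (c : GL (Fin r) Γ(X.C, U)) :
    (germUnit x hx (Matrix.GeneralLinearGroup.det c) : X.C.presheaf.stalk x) =
      (germMatrix x hx c.1).det :=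
  RingHom.map_det (X.C.presheaf.germ U x hx).hom c.1

theorem germUnit_det (i j l : d.cov.I) (x : X.C) (hx : x ∈ d.cov.U₃ i j l) :
    germUnit x (U := d.cov.U₂ i l) ⟨hx.1.1, hx.2⟩ (Matrix.GeneralLinearGroup.det (d.c i l)) =
      germUnit x hx.1 (Matrix.GeneralLinearGroup.det (d.c i j)) *
        germUnit x (U := d.cov.U₂ j l) ⟨hx.1.2, hx.2⟩
          (Matrix.GeneralLinearGroup.det (d.c j l)) := by
  ext
  refine (coe_germUnit_det x _ (d.c i l)).trans ?_
  rw [d.germMatrix_c i j l x hx, Matrix.det_mul]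
  exact (congrArg₂ (· * ·) (coe_germUnit_det x _ (d.c i j)) (coe_germUnit_det x _ (d.c j l))).symm

theorem ratLam_eq_mul (i j l : d.cov.I) (x : X.C) (hx : x ∈ d.cov.U₃ i j l) :
    d.ratLam i l = d.ratLam i j * d.ratLam j l := by
  have h := congrArg (fun w : (X.C.presheaf.stalk x)ˣ =>
    algebraMap _ X.C.functionField (w : X.C.presheaf.stalk x)) (d.germUnit_lam i j l x hx)
  rw [Units.val_mul, map_mul] at h
  refine ((algebraMap_germ x _ _).symm.trans h).trans ?_
  exact congrArg₂ (· * ·) (algebraMap_germ x _ _) (algebraMap_germ x _ _)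

theorem dlogLam_add (i j l : d.cov.I) (x : X.C) (hx : x ∈ d.cov.U₃ i j l) :
    d.dlogLam i l = d.dlogLam i j + d.dlogLam j l := by
  have h := d.ratLam_eq_mul i j l x hx
  have hne (i j : d.cov.I) : d.ratLam i j ≠ 0 := left_ne_zero_of_mul_eq_one (d.ratLam_mul i j)
  change dlogForm k _ (d.ratLam i l) = _
  rw [h, dlogForm_mul (hne _ _) (hne _ _)]
  rfl

theorem dlogLam_mem_reg1 (i j : d.cov.I) (x : X.C) (hx : x ∈ d.cov.U₂ i j) :
    d.dlogLam i j ∈ X.reg1 k x := by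
  refine dlog_mem_reg1 (rat_mem_localRing _ hx _) ?_
  have := d.ratLam'_eq i j
  rw [ratLam] at this
  rw [← this]
  exact rat_mem_localRing _ hx _

theorem trace_ω_mem (i : d.cov.I) (x : X.C) (hx : x ∈ d.cov.U i) :
    (d.ω i).trace ∈ polar1 k 𝓓 x :=
  sum_mem fun a _ => d.ω_polar i a a x hx

theorem traceForm_mem (i : d.cov.I) (x : X.C) (hx : x ∈ d.cov.U i) :
    d.traceForm i ∈ polar2 k 𝓓 x :=
  sum_mem fun a _ => sum_mem fun _ _ => sum_mem fun t _ => wedge_mem_polar2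
    (smul_mem_of_mem _ (rat_mem_localRing _ hx _) (D_mem_reg1 (rat_mem_localRing _ hx _)))
    (d.ω_polar i t a x hx)

theorem cochain_mem_cochains2 : d.cochain ∈ d.cov.cochains2 𝓓 := by
  refine ⟨fun i j l x => ?_, fun i j => ?_, fun i x => ?_⟩
  · refine ⟨d.cov.U₃ i j l, x.2, [(Units.map (X.C.presheaf.map
        (homOfLE (inf_le_left : d.cov.U₃ i j l ≤ d.cov.U₂ i j)).op).hom.toMonoidHom (d.lam i j),
      Units.map (X.C.presheaf.map (homOfLE (inf_le_inf_right _ inf_le_right :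
        d.cov.U₃ i j l ≤ d.cov.U₂ j l)).op).hom.toMonoidHom
          (Matrix.GeneralLinearGroup.det (d.c j l)))], fun y hy => ?_⟩
    rw [List.map_singleton, List.sum_singleton]
    refine congrArg₂ milnorSymbol ?_ ?_
    · ext
      exact (X.C.presheaf.germ_res_apply (homOfLE _) y.1 hy _).symm
    · ext
      exact (X.C.presheaf.germ_res_apply (homOfLE _) y.1 hy _).symm
  · simp only [polarSections, AddSubgroup.mem_iInf]
    exact fun x hx => wedge_mem_polar2 (d.dlogLam_mem_reg1 i j x hx) (d.trace_ω_mem j x hx.2)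
  · refine ⟨d.cov.U i, x.2, -d.traceForm i, ?_, fun y _ => rfl⟩
    simp only [polarSections, AddSubgroup.mem_iInf]
    exact fun x hx => neg_mem (d.traceForm_mem i x hx)

/-- Only the third condition uses that `g` commutes with the connection; the first two follow from
the transition data and the gauge formula. -/
theorem cochain_mem_cocycles2 (hg : Commutes nabla g) : d.cochain ∈ d.cov.cocycles2 𝓓 := by
  refine ⟨d.cochain_mem_cochains2, fun i j l m x => ?_, fun i j l x => ?_, fun i j x => ?_⟩
  · have h1 := d.germUnit_lam i j l x.1 x.2.1
    have h2 := d.germUnit_det j l m x.1 ⟨⟨x.2.1.1.2, x.2.1.2⟩, x.2.2⟩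
    change milnorSymbol (germUnit x.1 _ (d.lam j l)) (germUnit x.1 _ _) -
      milnorSymbol (germUnit x.1 _ (d.lam i l)) (germUnit x.1 _ _) +
      milnorSymbol (germUnit x.1 _ (d.lam i j)) (germUnit x.1 _ _) -
      milnorSymbol (germUnit x.1 _ (d.lam i j)) (germUnit x.1 _ _) = 0
    rw [h1, h2, milnorSymbol_mul_left, milnorSymbol_mul_right]
    abel
  · change wedge k _ (d.dlogLam j l) (d.ω l).trace - wedge k _ (d.dlogLam i l) (d.ω l).trace +
      wedge k _ (d.dlogLam i j) (d.ω j).trace = _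
    have e1 : algebraMap _ X.C.functionField (germUnit x.1 x.2.1 (d.lam i j)).1 = d.ratLam i j :=
      algebraMap_germ x.1 x.2.1 _
    have hx : x.1 ∈ d.cov.U₂ j l := ⟨x.2.1.2, x.2.2⟩
    have e2 : algebraMap _ X.C.functionField
        (germUnit x.1 hx (Matrix.GeneralLinearGroup.det (d.c j l))).1 =
        X.rat (d.nonempty₂ j l) (d.c j l).1.det :=
      algebraMap_germ x.1 hx _
    refine Eq.trans ?_ (dlogK2_milnorSymbol k X.C.functionField
      (germUnit x.1 x.2.1 (d.lam i j))
      (germUnit x.1 hx (Matrix.GeneralLinearGroup.det (d.c j l)))).symm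
    -- Additivity of `dlog λ` cancels the terms with `dlog λ_jl` and leaves `dlog λ_ij ∧ (Tr ω_j -
    -- Tr ω_l)`.
    rw [e1, e2, ← d.trace_sub_trace j l, d.dlogLam_add i j l x.1 x.2]
    change _ = wedge k _ (d.dlogLam i j) _
    simp only [map_add, map_sub, LinearMap.add_apply]
    abel
  · change (X.reg2 k x.1).mkQ (-d.traceForm j) - (X.reg2 k x.1).mkQ (-d.traceForm i) =
      (X.reg2 k x.1).mkQ (wedge k _ (d.dlogLam i j) (d.ω j).trace)
    rw [← map_sub, Submodule.mkQ_apply, Submodule.mkQ_apply, Submodule.Quotient.eq]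
    have := d.traceForm_sub_mem hg i j x.1 x.2
    -- The minus sign in the third component matches the orientation `c_j - c_i` of the Čech
    -- differential.
    rwa [show -d.traceForm j - -d.traceForm i = d.traceForm i - d.traceForm j by abel]

end LocalData

end CechCocycle

/-! ### Transition matrices between frames -/

section Choices

variable {k : Type v} {K : Type u} [Field k] [Field K] [Algebra k K] {X : SmoothCurve K}
  {𝓓 : RationalDivisor X} {E L : X.C.Modules} {r : ℕ}

open SmoothCurve

namespace SmoothCurve

/-- Two frames differ by an invertible matrix on the intersection of their domains. -/
theorem IsFrame.exists_transition {M : X.C.Modules} {U V : X.C.Opens} {e : Fin r → Γ(M, U)}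
    {f : Fin r → Γ(M, V)} (he : IsFrame M e) (hf : IsFrame M f) :
    ∃ c : GL (Fin r) Γ(X.C, U ⊓ V),
      ∀ a, res M inf_le_left (e a) = ∑ b, c a b • res M inf_le_right (f b) := by
  set v : Fin r → Γ(M, U ⊓ V) := fun a => res M inf_le_left (e a)
  set w : Fin r → Γ(M, U ⊓ V) := fun a => res M inf_le_right (f a)
  have hv : IsFrame M v := he.restrict inf_le_left
  have hw : IsFrame M w := hf.restrict inf_le_right
  choose A hA using fun a => (hf _ inf_le_right).2 (v a)
  choose B hB using fun a => (he _ inf_le_left).2 (w a)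
  have hA' : frameMul (Matrix.of A) w = v := funext hA
  have hB' : frameMul (Matrix.of B) v = w := funext hB
  -- Going from one frame to the other and back fixes the frame, so uniqueness of coordinates makes
  -- the two matrices inverse to each other.
  have cancel {z : Fin r → Γ(M, U ⊓ V)} (hz : IsFrame M z)
      {P : Matrix (Fin r) (Fin r) Γ(X.C, U ⊓ V)} (h : frameMul P z = z) : P = 1 := by
    funext a
    refine hz.ext ?_
    exact (congrFun h a).trans
      (congrFun (frameMul_one (R := Γ(X.C, U ⊓ V)) z) a).symm
  refine ⟨⟨Matrix.of A, Matrix.of B, cancel hv ?_, cancel hw ?_⟩, fun a => (hA a).symm⟩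
  · rw [frameMul_mul, hB', hA']
  · rw [frameMul_mul, hA', hB']

theorem IsFrame.exists_transition_unit {M : X.C.Modules} {U V : X.C.Opens} {l : Γ(M, U)}
    {l' : Γ(M, V)} (hl : IsFrame M fun _ : Fin 1 => l) (hl' : IsFrame M fun _ : Fin 1 => l') :
    ∃ c : Γ(X.C, U ⊓ V)ˣ,
      res M inf_le_left l = (c : Γ(X.C, U ⊓ V)) • res M inf_le_right l' := by
  obtain ⟨c, hc⟩ := hl.exists_transition hl'
  refine ⟨Matrix.GeneralLinearGroup.det c, ?_⟩
  rw [hc 0, Fin.sum_univ_one, Matrix.GeneralLinearGroup.val_det_apply, Matrix.det_fin_one]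

end SmoothCurve

/-! ### Independence of the choices -/

/-- The disjoint union of two coverings. -/
def Covering.sum (𝒰 𝒱 : Covering X) : Covering X where
  I := 𝒰.I ⊕ 𝒱.I
  U := Sum.elim 𝒰.U 𝒱.U
  nonempty := by
    rintro (i | i)
    · exact 𝒰.nonempty i
    · exact 𝒱.nonempty i
  iSup_eq_top := by
    rw [iSup_sum]
    simp [𝒰.iSup_eq_top, 𝒱.iSup_eq_top]

namespace LocalData

variable {nabla : PolarConnection k 𝓓 E} {g : TrivializationAlong 𝓓 E L}

/-- Two systems of choices combine to one for the disjoint union of the coverings. -/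
def sum (d d' : LocalData r nabla g) : LocalData r nabla g where
  cov := d.cov.sum d'.cov
  e i := match i with
    | .inl i => d.e i
    | .inr i => d'.e i
  isFrame_e i := match i with
    | .inl i => d.isFrame_e i
    | .inr i => d'.isFrame_e i
  ell i := match i with
    | .inl i => d.ell i
    | .inr i => d'.ell i
  isFrame_ell i := match i with
    | .inl i => d.isFrame_ell i
    | .inr i => d'.isFrame_ell i
  c i j := match i, j with
    | .inl i, .inl j => d.c i j
    | .inr i, .inr j => d'.c i j
    -- Only the mixed transition matrices are new; the trivialization imposes no condition between
    -- members, since the relation between `μ_i` and `μ_j` follows from the normalization.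
    | .inl i, .inr j => ((d.isFrame_e i).exists_transition (d'.isFrame_e j)).choose
    | .inr i, .inl j => ((d'.isFrame_e i).exists_transition (d.isFrame_e j)).choose
  c_spec i j := match i, j with
    | .inl i, .inl j => d.c_spec i j
    | .inr i, .inr j => d'.c_spec i j
    | .inl i, .inr j => ((d.isFrame_e i).exists_transition (d'.isFrame_e j)).choose_spec
    | .inr i, .inl j => ((d'.isFrame_e i).exists_transition (d.isFrame_e j)).choose_spec
  lam i j := match i, j with
    | .inl i, .inl j => d.lam i j
    | .inr i, .inr j => d'.lam i j
    | .inl i, .inr j => ((d.isFrame_ell i).exists_transition_unit (d'.isFrame_ell j)).choose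
    | .inr i, .inl j => ((d'.isFrame_ell i).exists_transition_unit (d.isFrame_ell j)).choose
  lam_spec i j := match i, j with
    | .inl i, .inl j => d.lam_spec i j
    | .inr i, .inr j => d'.lam_spec i j
    | .inl i, .inr j => ((d.isFrame_ell i).exists_transition_unit (d'.isFrame_ell j)).choose_spec
    | .inr i, .inl j => ((d'.isFrame_ell i).exists_transition_unit (d.isFrame_ell j)).choose_spec
  ω i := match i with
    | .inl i => d.ω i
    | .inr i => d'.ω i
  ω_polar i := match i with
    | .inl i => d.ω_polar i
    | .inr i => d'.ω_polar i
  ω_spec i := match i with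
    | .inl i => d.ω_spec i
    | .inr i => d'.ω_spec i
  μ i := match i with
    | .inl i => d.μ i
    | .inr i => d'.μ i
  μ_spec i := match i with
    | .inl i => d.μ_spec i
    | .inr i => d'.μ_spec i

theorem refines_inl (d d' : LocalData r nabla g) :
    Covering.Refines (d.sum d').cov d.cov Sum.inl := fun _ => le_rfl

theorem refines_inr (d d' : LocalData r nabla g) :
    Covering.Refines (d.sum d').cov d'.cov Sum.inr := fun _ => le_rfl

/-- True by definition, since the merged data keep the given choices within each of the two
coverings. -/
theorem restrict_inl (d d' : LocalData r nabla g) :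
    Covering.restrict (refines_inl d d') (d.sum d').cochain = d.cochain := rfl

theorem restrict_inr (d d' : LocalData r nabla g) :
    Covering.restrict (refines_inr d d') (d.sum d').cochain = d'.cochain := rfl

end LocalData

theorem RationalDivisor.cechClass_eq_of_restrict {𝒰 𝒱 : Covering X} {ρ : 𝒱.I → 𝒰.I}
    (h : Covering.Refines 𝒰 𝒱 ρ) (z : 𝒰.cocycles2 (k := k) 𝓓) (z' : 𝒱.cocycles2 (k := k) 𝓓)
    (hz : Covering.restrict h z.1 = z'.1) : 𝓓.cechClass 𝒱 z' = 𝓓.cechClass 𝒰 z := by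
  rw [cechClass, cechClass, ← sub_eq_zero, ← QuotientAddGroup.mk_sub,
    QuotientAddGroup.eq_zero_iff]
  exact AddSubgroup.subset_closure (Or.inr ⟨𝒰, 𝒱, ρ, h, z, z', hz.symm, rfl⟩)

namespace LocalData

variable {nabla : PolarConnection k 𝓓 E} {g : TrivializationAlong 𝓓 E L}

/-- The class of the cocycle does not depend on the choices. -/
theorem cechClass_eq (hg : Commutes nabla g) (d d' : LocalData r nabla g) :
    𝓓.cechClass d.cov ⟨d.cochain, d.cochain_mem_cocycles2 hg⟩ =
      𝓓.cechClass d'.cov ⟨d'.cochain, d'.cochain_mem_cocycles2 hg⟩ :=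
  (𝓓.cechClass_eq_of_restrict (refines_inl d d')
    ⟨(d.sum d').cochain, (d.sum d').cochain_mem_cocycles2 hg⟩ _ (restrict_inl d d')).trans
  (𝓓.cechClass_eq_of_restrict (refines_inr d d')
    ⟨(d.sum d').cochain, (d.sum d').cochain_mem_cocycles2 hg⟩ _ (restrict_inr d d')).symm

end LocalData

/-! ### Existence of the choices -/

/-- A section of a separated morphism is a closed immersion, and its source here is a single point.
-/
theorem RationalDivisor.isClosed_singleton {x : X.C} (hx : x ∈ 𝓓.mult.support) :
    IsClosed ({x} : Set X.C) := by
  obtain ⟨s, hs, y, rfl⟩ := 𝓓.rational x hx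
  have : IsClosedImmersion (s ≫ X.str) := by rw [hs]; infer_instance
  have : IsClosedImmersion s := IsClosedImmersion.of_comp s X.str
  have hr : ({s y} : Set X.C) = Set.range s := by
    ext z
    constructor
    · rintro rfl
      exact ⟨y, rfl⟩
    · rintro ⟨y', rfl⟩
      rw [Subsingleton.elim (α := PrimeSpectrum K) y' y]
      rfl
  rw [hr]
  exact s.isClosedEmbedding.isClosed_range

theorem along_subsingleton {x : X.C} (h : 𝓓.mult x = 0) (M : Type u) [AddCommGroup M]
    [Module (X.C.presheaf.stalk x) M] : Subsingleton (Along 𝓓 x M) := by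
  rw [Submodule.Quotient.subsingleton_iff, h, maxPow, pow_zero, Ideal.one_eq_top,
    Submodule.top_smul]

/-- The matrix of a trivialization at a point of the divisor lifts to the local ring. -/
theorem exists_isUnit_det_lift (g : TrivializationAlong 𝓓 E L) {U : X.C.Opens}
    {e : Fin r → Γ(E, U)} (he : IsFrame E e) {l : Γ(L, U)} (hl : IsFrame L fun _ : Fin 1 => l)
    (x : X.C) (hx : x ∈ U) : ∃ A : Matrix (Fin r) (Fin r) (X.C.presheaf.stalk x), IsUnit A.det ∧
      ∀ a, g x (Submodule.Quotient.mk (frameMul A (fun b => germ E x hx (e b)) a)) =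
        Submodule.Quotient.mk (germ E x hx (e a) ⊗ₜ germ L x hx l) := by
  -- Off the support the fibres along the divisor are zero, so the identity matrix will do.
  by_cases h : 𝓓.mult x = 0
  · have := along_subsingleton h (stalk E x ⊗[X.C.presheaf.stalk x] stalk L x)
    exact ⟨1, by simp, fun a => Subsingleton.elim _ _⟩
  set v : Fin r → stalk E x := fun b => germ E x hx (e b)
  set w : Fin r → stalk E x ⊗[X.C.presheaf.stalk x] stalk L x := fun a => v a ⊗ₜ germ L x hx l
  let bE := he.basis x hx
  let bEL := bE.tensorProduct (hl.basis x hx)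
  have hbE (z : stalk E x) : ∑ b, bE.repr z b • v b = z := by
    conv_rhs => rw [← bE.sum_repr z]
    exact Finset.sum_congr rfl fun b _ => by rw [he.basis_apply]
  have hbEL (z) : ∑ b, bEL.repr z (b, 0) • w b = z := by
    conv_rhs => rw [← bEL.sum_repr z]
    rw [Fintype.sum_prod_type]
    exact Finset.sum_congr rfl fun b _ => by
      rw [Fin.sum_univ_one, Module.Basis.tensorProduct_apply, he.basis_apply, hl.basis_apply]
  choose z hz using fun a => Submodule.Quotient.mk_surjective _
    ((g x).symm (Submodule.Quotient.mk (w a)))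
  choose y hy using fun a => Submodule.Quotient.mk_surjective _
    (g x (Submodule.Quotient.mk (v a)))
  let A : Matrix (Fin r) (Fin r) (X.C.presheaf.stalk x) := Matrix.of fun a b => bE.repr (z a) b
  let B : Matrix (Fin r) (Fin r) (X.C.presheaf.stalk x) :=
    Matrix.of fun a b => bEL.repr (y a) (b, 0)
  have hA (a : Fin r) : frameMul A v a = z a := hbE (z a)
  have hB (a : Fin r) : frameMul B w a = y a := hbEL (y a)
  have hgA (a : Fin r) : g x (Submodule.Quotient.mk (frameMul A v a)) =
      Submodule.Quotient.mk (w a) := by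
    rw [hA, hz, LinearEquiv.apply_symm_apply]
  refine ⟨A, ?_, hgA⟩
  -- `A` lifts the matrix of `g⁻¹` and `B` that of `g`, so `A * B` is the identity along the
  -- divisor.
  have hAB (a : Fin r) : (Submodule.Quotient.mk (frameMul (A * B) w a) : Along 𝓓 x _) =
      Submodule.Quotient.mk (w a) := by
    rw [← hgA a, frameMul_mul, frameMul, frameMul]
    simp only [hB, ← Submodule.mkQ_apply, map_sum, map_smul]
    exact Finset.sum_congr rfl fun b _ => by
      simp only [Submodule.mkQ_apply, hy]
  have hmem (a b : Fin r) : (A * B) a b - (1 : Matrix (Fin r) (Fin r) _) a b ∈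
      IsLocalRing.maximalIdeal (X.C.presheaf.stalk x) := by
    have h1 := (Submodule.Quotient.eq _).mp (hAB a)
    have h2 := repr_mem_of_mem_smul_top bEL h1 (b, 0)
    have hw (c : Fin r) : w c = bEL (c, 0) := by
      rw [Module.Basis.tensorProduct_apply, he.basis_apply, hl.basis_apply]
    have h3 : bEL.repr (frameMul (A * B) w a - w a) (b, 0) =
        (A * B) a b - (1 : Matrix (Fin r) (Fin r) _) a b := by
      rw [map_sub, Finsupp.sub_apply, frameMul]
      simp [hw, Finsupp.single_apply, Matrix.one_apply]
    rw [h3] at h2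
    -- The multiplicity is positive here, so a congruence along the divisor implies one modulo the
    -- maximal ideal; the determinant of `A` is then nonzero in the residue field.
    exact Ideal.pow_le_self h h2
  have hres : (A * B).map (IsLocalRing.residue (X.C.presheaf.stalk x)) = 1 := by
    ext a b
    have := (IsLocalRing.residue_eq_zero_iff _).mpr (hmem a b)
    rw [map_sub, sub_eq_zero] at this
    rw [Matrix.map_apply, this]
    simp [Matrix.one_apply, apply_ite]
  have hdet := congrArg Matrix.det hres
  rw [Matrix.det_one, ← RingHom.mapMatrix_apply, ← RingHom.map_det, Matrix.det_mul, map_mul] at hdet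
  exact (IsLocalRing.residue_ne_zero_iff_isUnit _).mp (left_ne_zero_of_mul_eq_one hdet)

/-- Every point has a neighbourhood with frames and a lifting of the matrix of the
trivialization. -/
theorem exists_chart (hE : IsBundle E r) (hL : IsBundle L 1) (g : TrivializationAlong 𝓓 E L)
    (x : X.C) : ∃ (U : X.C.Opens) (e : Fin r → Γ(E, U)) (l : Γ(L, U)) (μ : GL (Fin r) Γ(X.C, U)),
      x ∈ U ∧ IsFrame E e ∧ IsFrame L (fun _ : Fin 1 => l) ∧ ∀ a y, ∀ hy : y ∈ U,
        g y (Submodule.Quotient.mk (germ E y hy (∑ b, μ a b • e b))) =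
          Submodule.Quotient.mk (germ E y hy (e a) ⊗ₜ germ L y hy l) := by
  classical
  obtain ⟨U₁, hU₁, e, he⟩ := hE x
  obtain ⟨U₂, hU₂, l, hl⟩ := hL x
  -- Removing the other points of the divisor leaves `x` as the only point where the lifting
  -- condition can be nontrivial.
  have hclosed : IsClosed (((𝓓.mult.support.erase x : Finset X.C) : Set X.C)) := by
    rw [← Set.biUnion_of_singleton ((𝓓.mult.support.erase x : Finset X.C) : Set X.C)]
    exact (Finset.finite_toSet _).isClosed_biUnion fun y hy =>
      𝓓.isClosed_singleton (Finset.mem_of_mem_erase (Finset.mem_coe.mp hy))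
  let U₃ : X.C.Opens := ⟨_, hclosed.isOpen_compl⟩
  have hU₃ : x ∈ U₃ := by
    change x ∉ ((𝓓.mult.support.erase x : Finset X.C) : Set X.C)
    simp
  have hmult (y : X.C) (hy : y ∈ U₃) (hyx : y ≠ x) : 𝓓.mult y = 0 := by
    by_contra h
    exact hy (Finset.mem_coe.mpr (Finset.mem_erase.mpr ⟨hyx, Finsupp.mem_support_iff.mpr h⟩))
  let U : X.C.Opens := U₁ ⊓ U₂ ⊓ U₃
  have hxU : x ∈ U := ⟨⟨hU₁, hU₂⟩, hU₃⟩
  have hUU₁ : U ≤ U₁ := inf_le_left.trans inf_le_left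
  have hUU₂ : U ≤ U₂ := inf_le_left.trans inf_le_right
  have he' := he.restrict hUU₁
  have hl' : IsFrame L fun _ : Fin 1 => res L hUU₂ (l 0) := by
    have := hl.restrict hUU₂
    rwa [show (fun i => res L hUU₂ (l i)) = fun _ : Fin 1 => res L hUU₂ (l 0) from
      funext fun i => by rw [Subsingleton.elim i 0]] at this
  obtain ⟨A, hA, hgA⟩ := exists_isUnit_det_lift g he' hl' x hxU
  obtain ⟨V, hxV, hVU, f, hf⟩ := exists_germs hxU fun p : Fin r × Fin r => A p.1 p.2
  let N : Matrix (Fin r) (Fin r) Γ(X.C, V) := Matrix.of fun a b => f (a, b)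
  have hN : N.map (X.C.presheaf.germ V x hxV).hom = A := by
    ext a b
    exact hf (a, b)
  have hdet : IsUnit (X.C.presheaf.germ V x hxV N.det) := by
    rw [← hN, ← RingHom.mapMatrix_apply, ← RingHom.map_det] at hA
    exact hA
  -- Invertibility of the determinant at `x` spreads to a neighbourhood, where the lifted matrix is
  -- invertible.
  obtain ⟨W, i, hxW, hunit⟩ :=
    RingedSpace.isUnit_res_of_isUnit_germ X.C.toRingedSpace V N.det x hxV hdet
  have hWV : W ≤ V := leOfHom i
  let ρ : Γ(X.C, V) →+* Γ(X.C, W) := (X.C.presheaf.map (homOfLE hWV).op).hom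
  have hunit' : IsUnit (N.map ρ).det := by
    rw [← RingHom.mapMatrix_apply, ← RingHom.map_det]
    exact hunit
  refine ⟨W, fun a => res E ((hWV.trans hVU).trans hUU₁) (e a),
    res L ((hWV.trans hVU).trans hUU₂) (l 0), Matrix.nonsingInvUnit _ hunit', hxW,
    he.restrict _, ?_, fun a y hy => ?_⟩
  · simpa only [res_res] using hl'.restrict (hWV.trans hVU)
  · by_cases hyx : y = x
    · subst hyx
      rw [germ_sum]
      simp only [SmoothCurve.germ_res] at hgA ⊢
      rw [← hgA a, frameMul]
      congr 2
      refine Finset.sum_congr rfl fun b _ => ?_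
      congr 1
      rw [← hf (a, b)]
      exact X.C.presheaf.germ_res_apply (homOfLE hWV) y hy _
    · have := along_subsingleton (hmult y (hVU (hWV hy)).2 hyx)
        (stalk E y ⊗[X.C.presheaf.stalk y] stalk L y)
      exact Subsingleton.elim _ _

/-- The covering is indexed by the points of the curve, with one chart for each. The connection
matrices are the coordinates of `∇ e_i` in the frame. -/
theorem nonempty_localData (hE : IsBundle E r) (hL : IsBundle L 1)
    (nabla : PolarConnection k 𝓓 E) (g : TrivializationAlong 𝓓 E L) :
    Nonempty (LocalData r nabla g) := by
  choose U e l μ hU he hl hμ using exists_chart (𝓓 := 𝓓) hE hL g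
  let cov : Covering X :=
    { I := X.C
      U := U
      nonempty := fun x => ⟨⟨x, hU x⟩⟩
      iSup_eq_top := top_le_iff.mp fun x _ => Opens.mem_iSup.mpr ⟨x, hU x⟩ }
  choose c hc using fun i j => (he i).exists_transition (he j)
  choose lam hlam using fun i j => (hl i).exists_transition_unit (hl j)
  exact ⟨{
    cov := cov
    e := e
    isFrame_e := he
    ell := l
    isFrame_ell := hl
    c := c
    c_spec := hc
    lam := lam
    lam_spec := hlam
    ω := fun i => Matrix.of fun a b => tensorCoord ((he i).genericBasis (cov.nonempty i)) b
      (nabla.app (cov.nonempty i) (e i a))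
    ω_polar := fun i a b x hx => isPolar1_tensorCoord nabla (cov.nonempty i) (he i) (e i a) b x hx
    ω_spec := fun i a => by
      conv_lhs => rw [← sum_tmul_tensorCoord ((he i).genericBasis (cov.nonempty i))
        (nabla.app (cov.nonempty i) (e i a))]
      exact Finset.sum_congr rfl fun b _ => by rw [IsFrame.genericBasis_apply]; rfl
    μ := μ
    μ_spec := hμ }⟩

end Choices

end

theorem theorem5 {k : Type v} {K : Type u} [Field k] [IsAlgClosed k] [CharZero k] [Field K]
    [Algebra k K] (X : SmoothCurve K) (𝓓 : RationalDivisor X) (r : ℕ) (E L : X.C.Modules)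
    (hE : SmoothCurve.IsBundle E r) (hL : SmoothCurve.IsBundle L 1) (nabla : PolarConnection k 𝓓 E)
    (g : TrivializationAlong 𝓓 E L) (hg : Commutes nabla g) :
    Nonempty (LocalData r nabla g) ∧
      ∃! ξ : 𝓓.HyperH2 k, ∀ d : LocalData r nabla g,
        ∃ h : d.cochain ∈ d.cov.cocycles2 𝓓, 𝓓.cechClass d.cov ⟨d.cochain, h⟩ = ξ := by
  obtain ⟨d₀⟩ := nonempty_localData hE hL nabla g
  refine ⟨⟨d₀⟩, 𝓓.cechClass d₀.cov ⟨d₀.cochain, d₀.cochain_mem_cocycles2 hg⟩,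
    fun d => ⟨d.cochain_mem_cocycles2 hg, d.cechClass_eq hg d₀⟩, fun ξ hξ => ?_⟩
  -- Uniqueness of the class is not vacuous because at least one system of choices exists.
  obtain ⟨_, h⟩ := hξ d₀
  exact h.symm
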